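/- **The calculus $F_\omega^{ha}$.** Kinds are generated by $ty$ and $k \Rightarrow_k l$. The judgement forms are: elements $\mathrm{el}\,k$ of a kind; terms $\mathrm{tm}\,A$ and computations $\mathrm{co}\,H\,A$ (for types $A : \mathrm{el}\,ty$); raw higher-order functors $H$; handlers $h$ of $H$. Contexts consist of variables $\alpha : \mathrm{el}\,k$ and $x : \mathrm{tm}\,A$. Judgemental equality is the least congruence on well-typed expressions (compatible with substitution, and with respect to which typing is closed under conversion) containing the laws listed below. Write $efty = ty \Rightarrow_k ty$, $\mathrm{trans}\,F\,G = \forall\alpha.\,F\alpha \Rightarrow G\alpha$ and $\mathrm{fmapty}\,F = \forall\alpha\,\beta.\,(\alpha\Rightarrow\beta)\Rightarrow F\alpha\Rightarrow F\beta$. * Elements of $k\Rightarrow_k l$ are the $\lambda$-abstractions and applications of kinds, with $\beta\eta$. Types are $unit$, $bool$, $A\Rightarrow B$, $\forall_k\,\alpha.\,A$ for every kind $k$, and thunk types $\mathrm{th}\,H\,A$. * Terms: $unit$ has exactly one term $\star$ up to equality ($\eta$); $A \Rightarrow B$ and $\forall_k\,\alpha.\,A$ have abstraction and application with $\beta\eta$;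 $bool$ has constants $tt$, $ff$; mutually inverse operations $\Uparrow : \mathrm{tm}(\mathrm{th}\,H\,A)\to \mathrm{co}\,H\,A$ and $\Downarrow$ in the opposite direction. * A raw functor is a pair of $F_0 : \mathrm{el}\,efty$ and a term of type $\mathrm{fmapty}\,F_0$. A raw monad consists of $M : \mathrm{el}\,efty$ with terms $\mathrm{ret} : \forall\alpha.\,\alpha\Rightarrow M\alpha$ and $\mathrm{bind} : \forall\alpha\,\beta.\,M\alpha\Rightarrow(\alpha\Rightarrow M\beta)\Rightarrow M\beta$ (no laws); it is a raw functor by $\lambda \alpha\,\beta\,f\,m.\,\mathrm{bind}\,\alpha\,\beta\,m\,(\lambda a.\,\mathrm{ret}\,\beta\,(f a))$. A raw higher-order functor $H$ consists of $H_0 : \mathrm{el}(efty \Rightarrow_k efty)$, a term $\mathrm{hfmap}\,F : \mathrm{fmapty}(H_0F_0)$ depending on a raw functor $F$, and a term $\mathrm{hmap}\,F\,G\,\tau : \mathrm{trans}(H_0F_0)(H_0G_0)$ depending on raw functors $F,G$ and $\tau : \mathrm{trans}\,F_0\,G_0$. A handler $h$ of $H$ is a raw monad $M$ with a term $\mathrm{malg}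 : \mathrm{trans}(H_0M)\,M$. * Computations: $\mathrm{val}\,a : \mathrm{co}\,H\,A$ for $a:\mathrm{tm}\,A$; $\mathrm{let}\,c\,k : \mathrm{co}\,H\,B$ for $c : \mathrm{co}\,H\,A$ and $k\,x : \mathrm{co}\,H\,B$ depending on $x : \mathrm{tm}\,A$; $\mathrm{op}\,p\,k : \mathrm{co}\,H\,B$ for $p : \mathrm{tm}(H_0\,(\mathrm{th}\,H)\,A)$ and $k$ as before. Laws: $\mathrm{let}\,(\mathrm{val}\,a)\,k = k\,a$; $\mathrm{let}\,c\,\mathrm{val} = c$; $\mathrm{let}\,(\mathrm{let}\,c\,k)\,k' = \mathrm{let}\,c\,(\lambda a.\,\mathrm{let}\,(k\,a)\,k')$; $\mathrm{let}\,(\mathrm{op}\,p\,k)\,k' = \mathrm{op}\,p\,(\lambda a.\,\mathrm{let}\,(k\,a)\,k')$. Thunks form a raw monad $\mathrm{th}\,H$ with $\mathrm{ret}\,x = \Downarrow(\mathrm{val}\,x)$ and $\mathrm{bind}\,m\,k = \Downarrow(\mathrm{let}\,(\Uparrow m)\,(\lambda a.\Uparrow(k\,a)))$. * Handling: $\mathrm{hdl}\,h\,c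 : \mathrm{tm}(M A)$ for $c : \mathrm{co}\,H\,A$, with $\mathrm{hdl}\,h\,(\mathrm{val}\,a) = \mathrm{ret}\,A\,a$ and $\mathrm{hdl}\,h\,(\mathrm{op}\,p\,k) = \mathrm{bind}\,A\,B\,(\mathrm{malg}\,A\,p')\,(\lambda a.\,\mathrm{hdl}\,h\,(k\,a))$, where $p' = \mathrm{hmap}\,(\mathrm{th}\,H)\,M\,(\lambda\alpha\,c.\,\mathrm{hdl}\,h\,(\Uparrow c))\,A\,p$. **The realizability model.** Let $\Lambda$ be the partial combinatory algebra of $\beta$-equivalence classes of closed $\lambda$-terms under application. An assembly over $\Lambda$ is a set $X$ with a non-empty set $|x|\subseteq\Lambda$ of realizers for every $x\in X$. Let $P$ be the set of partial equivalence relations (PERs) on $\Lambda$; a PER $R$ is regarded as the assembly of its equivalence classes, each class being realized by its members. For an assembly $X$ and a family $R_x \in P$ ($x\in X$), the PER $\Pi_{x:X} R_x$ relates $f,g$ iff $f\cdot n \mathrel{R_x} g\cdot m$ for all $x\in X$ and $n,m\in|x|$. Kinds are interpreted by $[\![ty]\!] = P$ and full function spaces, in which everything realizes every element; $bool$ by the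 PER with exactly two classes, those of the Church Booleans $\lambda xy.x$ (interpreting $tt$) and $\lambda xy.y$ (interpreting $ff$); $unit$ by the one-class PER; $\Rightarrow$ and $\forall_k$ by $\Pi$; and computations and thunks by $$[\![\mathrm{co}\,H\,A]\!] = [\![\mathrm{th}\,H\,A]\!] = (h : \mathrm{Handler}\,H)\to (B : P)\to (A\to h\,B)\to h\,B,$$ where a handler is realized by triples of realizers of $\mathrm{ret},\mathrm{bind},\mathrm{malg}$. Abstraction and application are interpreted as such, $\Uparrow,\Downarrow$ as identities, and $\mathrm{val}\,a = \lambda h\,B\,r.\,r\,a$; $\mathrm{let}\,c\,k = \lambda h\,C\,r.\,c\,h\,C\,(\lambda a.\,k\,a\,h\,C\,r)$; $\mathrm{hdl}\,h\,c = c\,h\,A\,(\mathrm{ret}\,A)$; $\mathrm{op}\,p\,k = \lambda h\,C\,r.\,\mathrm{bind}\,A\,C\,(\mathrm{malg}\,A\,(\mathrm{hmap}\,(\mathrm{th}\,H)\,h\,(\lambda\alpha\,c.\,\mathrm{hdl}\,h\,c)\,A\,p))\,(\lambda a.\,k\,a\,h\,C\,r)$. **Theorem.** To every closed term $t : \mathrm{tm}\,bool$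 of $F_\omega^{ha}$ one can assign a closed untyped $\lambda$-term $|t|$ such that 1. the interpretation of $t$ in the realizability model over $\Lambda$ is an element of $[\![bool]\!]$, and (the class of) $|t|$ realizes it; 2. $|t|$ $\beta$-normalises to a Church Boolean, $\lambda x y.x$ or $\lambda x y.y$; 3. if $t$ and $t'$ are judgementally equal, then $|t|$ and $|t'|$ normalise to the same Church Boolean. -/

import Mathlib

/-! # The untyped lambda-calculus and the combinatory algebra of closed lambda-terms -/

namespace LC

/-- Untyped lambda-terms in de Bruijn notation. -/
inductive Tm : Type
  | var (i : ℕ)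
  | app (t u : Tm)
  | lam (t : Tm)

/-- Lifting of a renaming under one binder. -/
def liftR (ξ : ℕ → ℕ) : ℕ → ℕ
  | 0 => 0
  | n + 1 => ξ n + 1

namespace Tm

def rename : Tm → (ℕ → ℕ) → Tm
  | var i, ξ => var (ξ i)
  | app t u, ξ => app (t.rename ξ) (u.rename ξ)
  | lam t, ξ => lam (t.rename (liftR ξ))

/-- Lifting of a substitution under one binder. -/
def liftS (σ : ℕ → Tm) : ℕ → Tm
  | 0 => var 0
  | n + 1 => (σ n).rename Nat.succ

def subst : Tm → (ℕ → Tm) → Tm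
  | var i, σ => σ i
  | app t u, σ => app (t.subst σ) (u.subst σ)
  | lam t, σ => lam (t.subst (liftS σ))

/-- The substitution replacing variable `0` by `u` and lowering the others. -/
def single (u : Tm) : ℕ → Tm
  | 0 => u
  | n + 1 => var n

/-- One-step beta-reduction, in any position. -/
inductive Step : Tm → Tm → Prop
  | beta (t u : Tm) : Step (app (lam t) u) (t.subst (single u))
  | appL {t t' : Tm} (u : Tm) : Step t t' → Step (app t u) (app t' u)
  | appR (t : Tm) {u u' : Tm} : Step u u' → Step (app t u) (app t u')
  | lam {t t' : Tm} : Step t t' → Step (lam t) (lam t')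

/-- A beta-normal form. -/
def Normal (t : Tm) : Prop := ∀ u, ¬ Step t u

/-- `t` normalises to `v`: it reduces to `v`, and `v` is beta-normal. -/
def NormalisesTo (t v : Tm) : Prop := Relation.ReflTransGen Step t v ∧ Normal v

/-- Beta-equivalence. -/
def BetaEq : Tm → Tm → Prop := Relation.EqvGen Step

/-- All free variables are `< n`. -/
def ClosedAt : ℕ → Tm → Prop
  | n, var i => i < n
  | n, app t u => t.ClosedAt n ∧ u.ClosedAt n
  | n, lam t => t.ClosedAt (n + 1)

/-- No free variables. -/
def Closed (t : Tm) : Prop := t.ClosedAt 0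

/-- The Church Booleans `λ x y. x` and `λ x y. y`. -/
def church : Bool → Tm
  | true => lam (lam (var 1))
  | false => lam (lam (var 0))

theorem church_closed (b : Bool) : (church b).Closed := by
  cases b <;> simp [church, Closed, ClosedAt]

theorem ClosedAt.mono {t : Tm} : ∀ {n m : ℕ}, n ≤ m → t.ClosedAt n → t.ClosedAt m := by
  induction t with
  | var i => intro n m h hi; exact lt_of_lt_of_le hi h
  | app t u iht ihu => intro n m h ⟨ht, hu⟩; exact ⟨iht h ht, ihu h hu⟩
  | lam t ih => intro n m h ht; exact ih (n := n + 1) (m := m + 1) (by omega) ht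

theorem ClosedAt.subst_eq {t : Tm} : ∀ {n : ℕ} {σ : ℕ → Tm},
    t.ClosedAt n → (∀ i < n, σ i = var i) → t.subst σ = t := by
  induction t with
  | var i => intro n σ h hσ; exact hσ i h
  | app t u iht ihu =>
    intro n σ h hσ
    simp [subst, iht h.1 hσ, ihu h.2 hσ]
  | lam t ih =>
    intro n σ h hσ
    have : t.subst (liftS σ) = t := ih (n := n + 1) h (by
      intro i hi
      cases i with
      | zero => rfl
      | succ i => simp [liftS, hσ i (by omega), rename])
    simp [subst, this]

theorem BetaEq.app {t t' u u' : Tm} (h : BetaEq t t') (h' : BetaEq u u') :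
    BetaEq (.app t u) (.app t' u') := by
  have h1 : ∀ v, BetaEq (.app t v) (.app t' v) := by
    intro v
    induction h with
    | rel _ _ h => exact .rel _ _ (.appL _ h)
    | refl _ => exact .refl _
    | symm _ _ _ ih => exact .symm _ _ ih
    | trans _ _ _ _ _ ih ih' => exact .trans _ _ _ ih ih'
  have h2 : ∀ v, BetaEq (.app v u) (.app v u') := by
    intro v
    induction h' with
    | rel _ _ h => exact .rel _ _ (.appR _ h)
    | refl _ => exact .refl _
    | symm _ _ _ ih => exact .symm _ _ ih
    | trans _ _ _ _ _ ih ih' => exact .trans _ _ _ ih ih'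
  exact .trans _ _ _ (h1 u) (h2 t')

end Tm

/-- Closed lambda-terms. -/
abbrev CTm : Type := {t : Tm // t.Closed}

instance betaSetoid : Setoid CTm where
  r t u := Tm.BetaEq t.1 u.1
  iseqv := ⟨fun _ => .refl _, fun h => .symm _ _ h, fun h h' => .trans _ _ _ h h'⟩

/-- The (total) combinatory algebra of beta-equivalence classes of closed lambda-terms. -/
def Alg : Type := Quotient betaSetoid

namespace Alg

/-- The class of a closed lambda-term. -/
def mk (t : CTm) : Alg := Quotient.mk betaSetoid t

/-- Application of the combinatory algebra. -/
def app : Alg → Alg → Alg :=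
  Quotient.map₂ (fun t u => ⟨.app t.1 u.1, ⟨t.2, u.2⟩⟩) (fun _ _ h _ _ h' => Tm.BetaEq.app h h')

/-- The class of a Church Boolean. -/
def church (b : Bool) : Alg := mk ⟨Tm.church b, Tm.church_closed b⟩

/-- Projections for the pairing `⟨a, b⟩ = λ z. z a b`. -/
def fst (n : Alg) : Alg := n.app (church true)
def snd (n : Alg) : Alg := n.app (church false)

theorem exists_pair (a b : Alg) : ∃ n : Alg, n.fst = a ∧ n.snd = b := by
  induction a using Quotient.inductionOn with | _ a => ?_
  induction b using Quotient.inductionOn with | _ b => ?_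
  have ha : a.1.ClosedAt 1 := a.2.mono (by omega)
  have hb : b.1.ClosedAt 1 := b.2.mono (by omega)
  have hsa : ∀ u, a.1.subst u = a.1 := fun u => a.2.subst_eq (by simp)
  have hsb : ∀ u, b.1.subst u = b.1 := fun u => b.2.subst_eq (by simp)
  refine ⟨mk ⟨.lam (.app (.app (.var 0) a.1) b.1), ⟨⟨Nat.zero_lt_one, ha⟩, hb⟩⟩, ?_, ?_⟩
  · refine Quotient.sound (.trans _ (.app (.app (Tm.church true) a.1) b.1) _ ?_
      (.trans _ (.app (.lam a.1) b.1) _ ?_ ?_))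
    · have := Tm.Step.beta (.app (.app (.var 0) a.1) b.1) (Tm.church true)
      simp only [Tm.subst, hsa, hsb] at this
      exact .rel _ _ this
    · have := Tm.Step.beta (.lam (.var 1)) a.1
      have hr : a.1.rename Nat.succ = a.1 := by
        have key : ∀ (t : Tm) (n : ℕ) (ξ : ℕ → ℕ), t.ClosedAt n → (∀ i < n, ξ i = i) →
            t.rename ξ = t := by
          intro t
          induction t with
          | var i => intro n ξ h hξ; simp [Tm.rename, hξ i h]
          | app t u iht ihu => intro n ξ h hξ; simp [Tm.rename, iht n ξ h.1 hξ, ihu n ξ h.2 hξ]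
          | lam t ih =>
            intro n ξ h hξ
            have := ih (n + 1) (liftR ξ) h (by
              intro i hi
              cases i with
              | zero => rfl
              | succ i => simp [liftR, hξ i (by omega)])
            simp [Tm.rename, this]
        exact key a.1 0 _ a.2 (by simp)
      simp only [Tm.subst, Tm.liftS, Tm.single, hr] at this
      exact .rel _ _ (.appL _ this)
    · have := Tm.Step.beta a.1 b.1
      rw [hsa] at this
      exact .rel _ _ this
  · refine Quotient.sound (.trans _ (.app (.app (Tm.church false) a.1) b.1) _ ?_
      (.trans _ (.app (.lam (.var 0)) b.1) _ ?_ ?_))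
    · have := Tm.Step.beta (.app (.app (.var 0) a.1) b.1) (Tm.church false)
      simp only [Tm.subst, hsa, hsb] at this
      exact .rel _ _ this
    · exact .rel _ _ (.appL _ (Tm.Step.beta (.lam (.var 0)) a.1))
    · exact .rel _ _ (Tm.Step.beta (.var 0) b.1)

end Alg

end LC

/-! # Syntax and equational theory of the calculus

Contexts, substitution and congruence, which a logical framework supplies implicitly, are spelled
out.  Closed kinds are generated by `ty` and `⇒`; the remaining judgement forms are `el k`, `tm A`,
`co H A`, and the records of raw higher-order functors and of handlers. -/

namespace FHa

inductive Kd : Type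
  | ty
  | arr (k l : Kd)
  deriving DecidableEq

/-- Endo-functions on types. -/
abbrev Kd.efty : Kd := .arr .ty .ty

/-- The kind of the object part of a higher-order functor. -/
abbrev Kd.htyco : Kd := .arr Kd.efty Kd.efty

/-- Raw expressions of all judgement forms, with all implicit arguments recorded, in de Bruijn
notation with one index space for variables `α : el k` and `x : tm A`. -/
inductive Ex : Type
  | var (i : ℕ)
  -- elements of kinds; `F` in `klam k l F` is under one binder `α : el k`
  | klam (k l : Kd) (F : Ex)
  | kapp (k l : Kd) (F A : Ex)
  -- types; `A` in `all k A` is under one binder `α : el k`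
  | unit
  | bool
  | fn (A B : Ex)
  | all (k : Kd) (A : Ex)
  | th (H A : Ex)
  -- a raw higher-order functor; `hfmap` is under the two binders `F₀, Ffmap` of a raw functor `F`,
  -- `hmap` is under the five binders `F₀, Ffmap, G₀, Gfmap, τ : tm (trans F₀ G₀)`
  | hfun (obj hfmap hmap : Ex)
  -- a handler: a raw monad with an algebra
  | hdlr (M ret bind malg : Ex)
  -- terms; `t` in `lam A B t` is under `x : tm A`; `A` and `t` in `tlam k A t`, and `A` in
  -- `tapp k A t F`, are under `α : el k`
  | star
  | tt
  | ff
  | lam (A B t : Ex)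
  | app (A B t u : Ex)
  | tlam (k : Kd) (A t : Ex)
  | tapp (k : Kd) (A t F : Ex)
  | down (H A c : Ex)
  | hdl (H A h c : Ex)
  -- computations; `k` is under `a : tm A`
  | up (H A t : Ex)
  | val (H A a : Ex)
  | letin (H A B c k : Ex)
  | op (H A B p k : Ex)

def liftR (ξ : ℕ → ℕ) : ℕ → ℕ
  | 0 => 0
  | n + 1 => ξ n + 1

namespace Ex

def rename : Ex → (ℕ → ℕ) → Ex
  | var i, ξ => var (ξ i)
  | klam k l F, ξ => klam k l (F.rename (liftR ξ))
  | kapp k l F A, ξ => kapp k l (F.rename ξ) (A.rename ξ)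
  | unit, _ => unit
  | bool, _ => bool
  | fn A B, ξ => fn (A.rename ξ) (B.rename ξ)
  | all k A, ξ => all k (A.rename (liftR ξ))
  | th H A, ξ => th (H.rename ξ) (A.rename ξ)
  | hfun o f m, ξ => hfun (o.rename ξ) (f.rename (liftR (liftR ξ)))
      (m.rename (liftR (liftR (liftR (liftR (liftR ξ))))))
  | hdlr M r b m, ξ => hdlr (M.rename ξ) (r.rename ξ) (b.rename ξ) (m.rename ξ)
  | star, _ => star
  | tt, _ => tt
  | ff, _ => ff
  | lam A B t, ξ => lam (A.rename ξ) (B.rename ξ) (t.rename (liftR ξ))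
  | app A B t u, ξ => app (A.rename ξ) (B.rename ξ) (t.rename ξ) (u.rename ξ)
  | tlam k A t, ξ => tlam k (A.rename (liftR ξ)) (t.rename (liftR ξ))
  | tapp k A t F, ξ => tapp k (A.rename (liftR ξ)) (t.rename ξ) (F.rename ξ)
  | down H A c, ξ => down (H.rename ξ) (A.rename ξ) (c.rename ξ)
  | hdl H A h c, ξ => hdl (H.rename ξ) (A.rename ξ) (h.rename ξ) (c.rename ξ)
  | up H A t, ξ => up (H.rename ξ) (A.rename ξ) (t.rename ξ)
  | val H A a, ξ => val (H.rename ξ) (A.rename ξ) (a.rename ξ)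
  | letin H A B c k, ξ =>
      letin (H.rename ξ) (A.rename ξ) (B.rename ξ) (c.rename ξ) (k.rename (liftR ξ))
  | op H A B p k, ξ =>
      op (H.rename ξ) (A.rename ξ) (B.rename ξ) (p.rename ξ) (k.rename (liftR ξ))

/-- Weakening by `n` variables. -/
def wk (n : ℕ) (e : Ex) : Ex := e.rename (· + n)

def liftS (σ : ℕ → Ex) : ℕ → Ex
  | 0 => var 0
  | n + 1 => (σ n).wk 1

def subst : Ex → (ℕ → Ex) → Ex
  | var i, σ => σ i
  | klam k l F, σ => klam k l (F.subst (liftS σ))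
  | kapp k l F A, σ => kapp k l (F.subst σ) (A.subst σ)
  | unit, _ => unit
  | bool, _ => bool
  | fn A B, σ => fn (A.subst σ) (B.subst σ)
  | all k A, σ => all k (A.subst (liftS σ))
  | th H A, σ => th (H.subst σ) (A.subst σ)
  | hfun o f m, σ => hfun (o.subst σ) (f.subst (liftS (liftS σ)))
      (m.subst (liftS (liftS (liftS (liftS (liftS σ))))))
  | hdlr M r b m, σ => hdlr (M.subst σ) (r.subst σ) (b.subst σ) (m.subst σ)
  | star, _ => star
  | tt, _ => tt
  | ff, _ => ff
  | lam A B t, σ => lam (A.subst σ) (B.subst σ) (t.subst (liftS σ))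
  | app A B t u, σ => app (A.subst σ) (B.subst σ) (t.subst σ) (u.subst σ)
  | tlam k A t, σ => tlam k (A.subst (liftS σ)) (t.subst (liftS σ))
  | tapp k A t F, σ => tapp k (A.subst (liftS σ)) (t.subst σ) (F.subst σ)
  | down H A c, σ => down (H.subst σ) (A.subst σ) (c.subst σ)
  | hdl H A h c, σ => hdl (H.subst σ) (A.subst σ) (h.subst σ) (c.subst σ)
  | up H A t, σ => up (H.subst σ) (A.subst σ) (t.subst σ)
  | val H A a, σ => val (H.subst σ) (A.subst σ) (a.subst σ)
  | letin H A B c k, σ =>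
      letin (H.subst σ) (A.subst σ) (B.subst σ) (c.subst σ) (k.subst (liftS σ))
  | op H A B p k, σ =>
      op (H.subst σ) (A.subst σ) (B.subst σ) (p.subst σ) (k.subst (liftS σ))

/-- Extension of a substitution by the value of variable `0`. -/
def scons (a : Ex) (σ : ℕ → Ex) : ℕ → Ex
  | 0 => a
  | n + 1 => σ n

/-- `t.inst a` is `t[a/0]`. -/
def inst (t a : Ex) : Ex := t.subst (scons a var)

/-! Derived notions.  Comments give the named form. -/

/-- `F A` for `F : el (ty ⇒ ty)`. -/
def tyapp (F A : Ex) : Ex := kapp .ty .ty F A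

/-- `H F` for `H : el (efty ⇒ efty)`. -/
def happ (H F : Ex) : Ex := kapp .efty .efty H F

/-- `∀ α β. (α ⇒ β) ⇒ (F α ⇒ F β)` -/
def fmapTy (F : Ex) : Ex :=
  all .ty (all .ty
    (fn (fn (var 1) (var 0)) (fn (tyapp (F.wk 2) (var 1)) (tyapp (F.wk 2) (var 0)))))

/-- `∀ α. F α ⇒ G α` -/
def trans (F G : Ex) : Ex :=
  all .ty (fn (tyapp (F.wk 1) (var 0)) (tyapp (G.wk 1) (var 0)))

/-- `t A` for `t : tm (trans F G)`. -/
def transAt (F G t A : Ex) : Ex :=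
  tapp .ty (fn (tyapp (F.wk 1) (var 0)) (tyapp (G.wk 1) (var 0))) t A

/-- `∀ α. α ⇒ M α` -/
def retTy (M : Ex) : Ex := all .ty (fn (var 0) (tyapp (M.wk 1) (var 0)))

/-- `ret A a` -/
def retApp (M ret A a : Ex) : Ex :=
  app A (tyapp M A) (tapp .ty (fn (var 0) (tyapp (M.wk 1) (var 0))) ret A) a

/-- `M A ⇒ (A ⇒ M B) ⇒ M B` -/
def bindBody (M A B : Ex) : Ex := fn (tyapp M A) (fn (fn A (tyapp M B)) (tyapp M B))

/-- `∀ α β. M α ⇒ (α ⇒ M β) ⇒ M β` -/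
def bindTy (M : Ex) : Ex := all .ty (all .ty (bindBody (M.wk 2) (var 1) (var 0)))

/-- `bind A B m k` -/
def bindApp (M bind A B m k : Ex) : Ex :=
  app (fn A (tyapp M B)) (tyapp M B)
    (app (tyapp M A) (fn (fn A (tyapp M B)) (tyapp M B))
      (tapp .ty (bindBody (M.wk 1) (A.wk 1) (var 0))
        (tapp .ty (all .ty (bindBody (M.wk 2) (var 1) (var 0))) bind A) B) m) k

/-- The `fmap` of the raw functor of a raw monad: `λ α β f m. bind α β m (λ a. ret β (f a))`. -/
def fctOfMnd (M ret bind : Ex) : Ex :=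
  tlam .ty (all .ty
      (fn (fn (var 1) (var 0)) (fn (tyapp (M.wk 2) (var 1)) (tyapp (M.wk 2) (var 0))))) <|
  tlam .ty (fn (fn (var 1) (var 0)) (fn (tyapp (M.wk 2) (var 1)) (tyapp (M.wk 2) (var 0)))) <|
  lam (fn (var 1) (var 0)) (fn (tyapp (M.wk 2) (var 1)) (tyapp (M.wk 2) (var 0))) <|
  lam (tyapp (M.wk 3) (var 2)) (tyapp (M.wk 3) (var 1)) <|
  bindApp (M.wk 4) (bind.wk 4) (var 3) (var 2) (var 0)
    (lam (var 3) (tyapp (M.wk 4) (var 2))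
      (retApp (M.wk 5) (ret.wk 5) (var 3) (app (var 4) (var 3) (var 2) (var 0))))

/-- The raw monad of thunks, object part: `λ α. th H α`. -/
def thObj (H : Ex) : Ex := klam .ty .ty (th (H.wk 1) (var 0))

/-- The raw monad of thunks, unit: `λ α x. ⇓ (val x)`. -/
def thRet (H : Ex) : Ex :=
  tlam .ty (fn (var 0) (tyapp ((thObj H).wk 1) (var 0))) <|
  lam (var 0) (tyapp ((thObj H).wk 1) (var 0)) <|
  down (H.wk 2) (var 1) (val (H.wk 2) (var 1) (var 0))

/-- The raw monad of thunks, bind: `λ α β m k. ⇓ (let-in (⇑ m) (λ a. ⇑ (k a)))`. -/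
def thBind (H : Ex) : Ex :=
  tlam .ty (all .ty (bindBody ((thObj H).wk 2) (var 1) (var 0))) <|
  tlam .ty (bindBody ((thObj H).wk 2) (var 1) (var 0)) <|
  lam (tyapp ((thObj H).wk 2) (var 1))
    (fn (fn (var 1) (tyapp ((thObj H).wk 2) (var 0))) (tyapp ((thObj H).wk 2) (var 0))) <|
  lam (fn (var 2) (tyapp ((thObj H).wk 3) (var 1))) (tyapp ((thObj H).wk 3) (var 1)) <|
  down (H.wk 4) (var 2)
    (letin (H.wk 4) (var 3) (var 2) (up (H.wk 4) (var 3) (var 1))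
      (up (H.wk 5) (var 3) (app (var 4) (tyapp ((thObj H).wk 5) (var 3)) (var 1) (var 0))))

/-- The transformation `λ α c. hdl h (⇑ c)` from thunks to the monad `M` of the handler `h`. -/
def hdlTrans (H M h : Ex) : Ex :=
  tlam .ty (fn (tyapp ((thObj H).wk 1) (var 0)) (tyapp (M.wk 1) (var 0))) <|
  lam (tyapp ((thObj H).wk 1) (var 0)) (tyapp (M.wk 1) (var 0)) <|
  hdl (H.wk 2) (var 1) (h.wk 2) (up (H.wk 2) (var 1) (var 0))

/-- `hmap F G τ`, for raw functors `F = (F₀, φ)` and `G = (G₀, γ)`. -/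
def hmapAt (hmap F₀ φ G₀ γ τ : Ex) : Ex :=
  hmap.subst (scons τ (scons γ (scons G₀ (scons φ (scons F₀ var)))))

/-- `H .hmap T M (λ α c. hdl h (⇑ c)) A p`, where `H = hfun obj hfmap hmap`,
`h = hdlr M ret bind malg`, and `T`, `M` are the raw functors of the raw monad of thunks and of
the raw monad of `h`. -/
def hdlArg (obj hfmap hmap M ret bind malg A p : Ex) : Ex :=
  let H := hfun obj hfmap hmap
  let h := hdlr M ret bind malg
  let T := thObj H
  app (tyapp (happ obj T) A) (tyapp (happ obj M) A)
    (transAt (happ obj T) (happ obj M)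
      (hmapAt hmap T (fctOfMnd T (thRet H) (thBind H)) M (fctOfMnd M ret bind)
        (hdlTrans H M h)) A) p

end Ex

/-- Judgement forms. -/
inductive Judg : Type
  | el (k : Kd)
  | tm (A : Ex)
  | co (H A : Ex)
  | hfun
  | hdlr (H : Ex)

def Judg.wk : Judg → Judg
  | el k => el k
  | tm A => tm (A.wk 1)
  | co H A => co (H.wk 1) (A.wk 1)
  | hfun => hfun
  | hdlr H => hdlr (H.wk 1)

/-- Contexts, most recent variable first.  All binders of the calculus bind a variable of one of the
judgement forms `el k` and `tm A`. -/
abbrev Ctx : Type := List Judg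

inductive Lookup : Ctx → ℕ → Judg → Prop
  | zero (Γ : Ctx) (J : Judg) : Lookup (J :: Γ) 0 J.wk
  | succ {Γ : Ctx} {i : ℕ} {J : Judg} (J' : Judg) : Lookup Γ i J → Lookup (J' :: Γ) (i + 1) J.wk

open Ex in
/-- Judgemental equality `Γ ⊢ e ≡ e' : J` of well-typed expressions.  Every formation rule is
stated as a rule deriving equal results from equal arguments; its typing rule is the reflexive
instance, so that the typing judgement `Γ ⊢ e : J` is `Γ ⊢ e ≡ e : J`. -/
inductive Eqv : Ctx → Ex → Ex → Judg → Prop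
  -- structural rules
  | var {Γ i J} : Lookup Γ i J → Eqv Γ (var i) (var i) J
  | symm {Γ e e' J} : Eqv Γ e e' J → Eqv Γ e' e J
  | trans {Γ e e' e'' J} : Eqv Γ e e' J → Eqv Γ e' e'' J → Eqv Γ e e'' J
  | convTm {Γ e e' A A'} : Eqv Γ A A' (.el .ty) → Eqv Γ e e' (.tm A) → Eqv Γ e e' (.tm A')
  | convCo {Γ e e' H H' A A'} : Eqv Γ H H' .hfun → Eqv Γ A A' (.el .ty) →
      Eqv Γ e e' (.co H A) → Eqv Γ e e' (.co H' A')
  | convHdlr {Γ e e' H H'} : Eqv Γ H H' .hfun → Eqv Γ e e' (.hdlr H) → Eqv Γ e e' (.hdlr H')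
  -- elements of kinds
  | klam {Γ k l F F'} : Eqv (.el k :: Γ) F F' (.el l) →
      Eqv Γ (klam k l F) (klam k l F') (.el (.arr k l))
  | kapp {Γ k l F F' A A'} : Eqv Γ F F' (.el (.arr k l)) → Eqv Γ A A' (.el k) →
      Eqv Γ (kapp k l F A) (kapp k l F' A') (.el l)
  | kbeta {Γ k l F A} : Eqv (.el k :: Γ) F F (.el l) → Eqv Γ A A (.el k) →
      Eqv Γ (kapp k l (klam k l F) A) (F.inst A) (.el l)
  | keta {Γ k l F} : Eqv Γ F F (.el (.arr k l)) →
      Eqv Γ (klam k l (kapp k l (F.wk 1) (var 0))) F (.el (.arr k l))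
  -- types
  | unit {Γ} : Eqv Γ unit unit (.el .ty)
  | bool {Γ} : Eqv Γ bool bool (.el .ty)
  | fn {Γ A A' B B'} : Eqv Γ A A' (.el .ty) → Eqv Γ B B' (.el .ty) →
      Eqv Γ (fn A B) (fn A' B') (.el .ty)
  | all {Γ k A A'} : Eqv (.el k :: Γ) A A' (.el .ty) → Eqv Γ (all k A) (all k A') (.el .ty)
  | th {Γ H H' A A'} : Eqv Γ H H' .hfun → Eqv Γ A A' (.el .ty) →
      Eqv Γ (th H A) (th H' A') (.el .ty)
  -- raw higher-order functors and handlers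
  | hfun {Γ o o' f f' m m'} : Eqv Γ o o' (.el .htyco) →
      Eqv (.tm (fmapTy (var 0)) :: .el .efty :: Γ) f f' (.tm (fmapTy (happ (o.wk 2) (var 1)))) →
      Eqv (.tm (trans (var 3) (var 1)) :: .tm (fmapTy (var 0)) :: .el .efty ::
          .tm (fmapTy (var 0)) :: .el .efty :: Γ) m m'
        (.tm (trans (happ (o.wk 5) (var 4)) (happ (o.wk 5) (var 2)))) →
      Eqv Γ (hfun o f m) (hfun o' f' m') .hfun
  | hdlr {Γ o f g M M' r r' b b' m m'} : Eqv Γ (hfun o f g) (hfun o f g) .hfun →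
      Eqv Γ M M' (.el .efty) → Eqv Γ r r' (.tm (retTy M)) → Eqv Γ b b' (.tm (bindTy M)) →
      Eqv Γ m m' (.tm (trans (happ o M) M)) →
      Eqv Γ (hdlr M r b m) (hdlr M' r' b' m') (.hdlr (hfun o f g))
  -- terms
  | star {Γ} : Eqv Γ star star (.tm unit)
  | unitEta {Γ t} : Eqv Γ t t (.tm unit) → Eqv Γ t star (.tm unit)
  | tt {Γ} : Eqv Γ tt tt (.tm bool)
  | ff {Γ} : Eqv Γ ff ff (.tm bool)
  | lam {Γ A A' B B' t t'} : Eqv Γ A A' (.el .ty) → Eqv Γ B B' (.el .ty) →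
      Eqv (.tm A :: Γ) t t' (.tm (B.wk 1)) → Eqv Γ (lam A B t) (lam A' B' t') (.tm (fn A B))
  | app {Γ A A' B B' t t' u u'} : Eqv Γ A A' (.el .ty) → Eqv Γ B B' (.el .ty) →
      Eqv Γ t t' (.tm (fn A B)) → Eqv Γ u u' (.tm A) →
      Eqv Γ (app A B t u) (app A' B' t' u') (.tm B)
  | beta {Γ A B t u} : Eqv Γ A A (.el .ty) → Eqv Γ B B (.el .ty) →
      Eqv (.tm A :: Γ) t t (.tm (B.wk 1)) → Eqv Γ u u (.tm A) →
      Eqv Γ (app A B (lam A B t) u) (t.inst u) (.tm B)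
  | eta {Γ A B t} : Eqv Γ A A (.el .ty) → Eqv Γ B B (.el .ty) → Eqv Γ t t (.tm (fn A B)) →
      Eqv Γ (lam A B (app (A.wk 1) (B.wk 1) (t.wk 1) (var 0))) t (.tm (fn A B))
  | tlam {Γ k A A' t t'} : Eqv (.el k :: Γ) A A' (.el .ty) → Eqv (.el k :: Γ) t t' (.tm A) →
      Eqv Γ (tlam k A t) (tlam k A' t') (.tm (all k A))
  | tapp {Γ k A A' t t' F F'} : Eqv (.el k :: Γ) A A' (.el .ty) → Eqv Γ t t' (.tm (all k A)) →
      Eqv Γ F F' (.el k) → Eqv Γ (tapp k A t F) (tapp k A' t' F') (.tm (A.inst F))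
  | tbeta {Γ k A t F} : Eqv (.el k :: Γ) A A (.el .ty) → Eqv (.el k :: Γ) t t (.tm A) →
      Eqv Γ F F (.el k) → Eqv Γ (tapp k A (tlam k A t) F) (t.inst F) (.tm (A.inst F))
  | teta {Γ k A t} : Eqv (.el k :: Γ) A A (.el .ty) → Eqv Γ t t (.tm (all k A)) →
      Eqv Γ (tlam k A (tapp k (A.rename (liftR (· + 1))) (t.wk 1) (var 0))) t (.tm (all k A))
  -- computations
  | val {Γ H H' A A' a a'} : Eqv Γ H H' .hfun → Eqv Γ A A' (.el .ty) → Eqv Γ a a' (.tm A) →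
      Eqv Γ (val H A a) (val H' A' a') (.co H A)
  | letin {Γ H H' A A' B B' c c' k k'} : Eqv Γ H H' .hfun → Eqv Γ A A' (.el .ty) →
      Eqv Γ B B' (.el .ty) → Eqv Γ c c' (.co H A) →
      Eqv (.tm A :: Γ) k k' (.co (H.wk 1) (B.wk 1)) →
      Eqv Γ (letin H A B c k) (letin H' A' B' c' k') (.co H B)
  | valLet {Γ H A B a k} : Eqv Γ H H .hfun → Eqv Γ A A (.el .ty) → Eqv Γ B B (.el .ty) →
      Eqv Γ a a (.tm A) → Eqv (.tm A :: Γ) k k (.co (H.wk 1) (B.wk 1)) →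
      Eqv Γ (letin H A B (val H A a) k) (k.inst a) (.co H B)
  | letVal {Γ H A c} : Eqv Γ H H .hfun → Eqv Γ A A (.el .ty) → Eqv Γ c c (.co H A) →
      Eqv Γ (letin H A A c (val (H.wk 1) (A.wk 1) (var 0))) c (.co H A)
  | letAssoc {Γ H A B C c k k'} : Eqv Γ H H .hfun → Eqv Γ A A (.el .ty) → Eqv Γ B B (.el .ty) →
      Eqv Γ C C (.el .ty) → Eqv Γ c c (.co H A) →
      Eqv (.tm A :: Γ) k k (.co (H.wk 1) (B.wk 1)) →
      Eqv (.tm B :: Γ) k' k' (.co (H.wk 1) (C.wk 1)) →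
      Eqv Γ (letin H B C (letin H A B c k) k')
        (letin H A C c (letin (H.wk 1) (B.wk 1) (C.wk 1) k (k'.rename (liftR (· + 1))))) (.co H C)
  -- thunks
  | down {Γ H H' A A' c c'} : Eqv Γ H H' .hfun → Eqv Γ A A' (.el .ty) → Eqv Γ c c' (.co H A) →
      Eqv Γ (down H A c) (down H' A' c') (.tm (th H A))
  | up {Γ H H' A A' t t'} : Eqv Γ H H' .hfun → Eqv Γ A A' (.el .ty) → Eqv Γ t t' (.tm (th H A)) →
      Eqv Γ (up H A t) (up H' A' t') (.co H A)
  | downUp {Γ H A t} : Eqv Γ H H .hfun → Eqv Γ A A (.el .ty) → Eqv Γ t t (.tm (th H A)) →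
      Eqv Γ (down H A (up H A t)) t (.tm (th H A))
  | upDown {Γ H A c} : Eqv Γ H H .hfun → Eqv Γ A A (.el .ty) → Eqv Γ c c (.co H A) →
      Eqv Γ (up H A (down H A c)) c (.co H A)
  -- operations
  | op {Γ o o' f f' m m' A A' B B' p p' k k'} :
      Eqv Γ (hfun o f m) (hfun o' f' m') .hfun → Eqv Γ A A' (.el .ty) → Eqv Γ B B' (.el .ty) →
      Eqv Γ p p' (.tm (tyapp (happ o (thObj (hfun o f m))) A)) →
      Eqv (.tm A :: Γ) k k' (.co ((hfun o f m).wk 1) (B.wk 1)) →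
      Eqv Γ (op (hfun o f m) A B p k) (op (hfun o' f' m') A' B' p' k') (.co (hfun o f m) B)
  | letOp {Γ o f m A B C p k k'} :
      Eqv Γ (hfun o f m) (hfun o f m) .hfun → Eqv Γ A A (.el .ty) → Eqv Γ B B (.el .ty) →
      Eqv Γ C C (.el .ty) → Eqv Γ p p (.tm (tyapp (happ o (thObj (hfun o f m))) A)) →
      Eqv (.tm A :: Γ) k k (.co ((hfun o f m).wk 1) (B.wk 1)) →
      Eqv (.tm B :: Γ) k' k' (.co ((hfun o f m).wk 1) (C.wk 1)) →
      Eqv Γ (letin (hfun o f m) B C (op (hfun o f m) A B p k) k')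
        (op (hfun o f m) A C p
          (letin ((hfun o f m).wk 1) (B.wk 1) (C.wk 1) k (k'.rename (liftR (· + 1)))))
        (.co (hfun o f m) C)
  -- handling
  | hdl {Γ H H' A A' M M' r r' b b' m m' c c'} : Eqv Γ H H' .hfun → Eqv Γ A A' (.el .ty) →
      Eqv Γ (hdlr M r b m) (hdlr M' r' b' m') (.hdlr H) → Eqv Γ c c' (.co H A) →
      Eqv Γ (hdl H A (hdlr M r b m) c) (hdl H' A' (hdlr M' r' b' m') c') (.tm (tyapp M A))
  | hdlVal {Γ H A M r b m a} : Eqv Γ H H .hfun → Eqv Γ A A (.el .ty) →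
      Eqv Γ (hdlr M r b m) (hdlr M r b m) (.hdlr H) → Eqv Γ a a (.tm A) →
      Eqv Γ (hdl H A (hdlr M r b m) (val H A a)) (retApp M r A a) (.tm (tyapp M A))
  | hdlOp {Γ o f g A B M r b m p k} : Eqv Γ (hfun o f g) (hfun o f g) .hfun →
      Eqv Γ A A (.el .ty) → Eqv Γ B B (.el .ty) →
      Eqv Γ (hdlr M r b m) (hdlr M r b m) (.hdlr (hfun o f g)) →
      Eqv Γ p p (.tm (tyapp (happ o (thObj (hfun o f g))) A)) →
      Eqv (.tm A :: Γ) k k (.co ((hfun o f g).wk 1) (B.wk 1)) →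
      Eqv Γ (hdl (hfun o f g) B (hdlr M r b m) (op (hfun o f g) A B p k))
        (bindApp M b A B
          (app (tyapp (happ o M) A) (tyapp M A) (transAt (happ o M) M m A)
            (hdlArg o f g M r b m A p))
          (lam A (tyapp M B)
            (hdl ((hfun o f g).wk 1) (B.wk 1) ((hdlr M r b m).wk 1) k)))
        (.tm (tyapp M B))

/-- Closed terms of type `bool`. -/
abbrev ClosedBool : Type := {t : Ex // Eqv [] t t (.tm .bool)}

/-- Judgemental equality of closed terms of type `bool`. -/
def ClosedBool.JEq (t t' : ClosedBool) : Prop := Eqv [] t.1 t'.1 (.tm .bool)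

end FHa

/-! # Assemblies over the algebra of lambda-terms -/

namespace Rz

open LC

/-- Assemblies over `Alg`; `real n x` means that `n` realizes `x`. -/
structure Asm where
  Carrier : Type
  real : Alg → Carrier → Prop
  exists_real : ∀ x, ∃ n, real n x

/-- The assembly on a set in which everything realizes every element. -/
def Asm.codisc (α : Type) : Asm := ⟨α, fun _ _ => True, fun _ => ⟨Alg.church true, trivial⟩⟩

/-- Partial equivalence relations on `Alg`: the elements of the impredicative universe `P`. -/
structure PER where
  rel : Alg → Alg → Prop
  symm : ∀ {a b}, rel a b → rel b a
  trans : ∀ {a b c}, rel a b → rel b c → rel a c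

instance : Inhabited PER := ⟨⟨fun _ _ => False, fun h => h, fun h _ => h⟩⟩

namespace PER

/-- `C` is an equivalence class. -/
def IsClass (R : PER) (C : Set Alg) : Prop := ∃ a, R.rel a a ∧ C = {b | R.rel a b}

/-- The assembly of a PER: its elements are the equivalence classes, and a class is realized by
its members. -/
def asm (R : PER) : Asm where
  Carrier := {C : Set Alg // R.IsClass C}
  real n C := n ∈ C.1
  exists_real := by rintro ⟨_, a, ha, rfl⟩; exact ⟨a, ha⟩

/-- The dependent product of a family of PERs indexed by an arbitrary assembly.  The class of a
section consists of all its realizers. -/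
def pi (X : Asm) (S : X.Carrier → PER) : PER where
  rel f g := ∀ x n m, X.real n x → X.real m x → (S x).rel (f.app n) (g.app m)
  symm h x n m hn hm := (S x).symm (h x m n hm hn)
  trans h h' x n m hn hm := (S x).trans (h x n n hn hn) (h' x n m hn hm)

/-- Function types. -/
def arr (R S : PER) : PER := pi R.asm fun _ => S

/-- The one-element type. -/
def one : PER := ⟨fun _ _ => True, fun _ => trivial, fun _ _ => trivial⟩

/-- The two-element type; its elements are realized by the two Church Booleans. -/
def two : PER where
  rel a b := ∃ c : Bool, a = Alg.church c ∧ b = Alg.church c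
  symm := by rintro _ _ ⟨c, rfl, rfl⟩; exact ⟨c, rfl, rfl⟩
  trans := by rintro _ _ _ ⟨c, rfl, rfl⟩ ⟨d, h, rfl⟩; exact ⟨d, h, rfl⟩

end PER

/-- The element of `PER.pi X S` given by a section: the set of its realizers. -/
def lamC (X : Asm) (s : X.Carrier → Set Alg) : Set Alg :=
  {f | ∀ x n, X.real n x → f.app n ∈ s x}

/-- The value in `S` of an element `F` of a product at an argument whose set of realizers is `N`. -/
def appC (S : PER) (F N : Set Alg) : Set Alg := {b | ∃ f ∈ F, ∃ n ∈ N, S.rel (f.app n) b}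

/-- Quantification over types, `(α : P) → S α`. -/
def allP (S : PER → PER) : PER := .pi (.codisc PER) S

/-- The element of `allP S` given by a family. -/
def lamP (s : PER → Set Alg) : Set Alg := lamC (.codisc PER) s

/-- The value in `S` of a polymorphic element at a type, all of `Alg` realizing every type. -/
def appP (S : PER) (F : Set Alg) : Set Alg := appC S F Set.univ

def retP (M : PER → PER) : PER := allP fun α => .arr α (M α)

def bindP (M : PER → PER) : PER :=
  allP fun α => allP fun β => .arr (M α) (.arr (.arr α (M β)) (M β))

def transP (F G : PER → PER) : PER := allP fun α => .arr (F α) (G α)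

/-- Underlying data of an element of the record of handlers. -/
structure Hdlr where
  M : PER → PER
  ret : Set Alg
  bind : Set Alg
  malg : Set Alg

instance : Inhabited Hdlr := ⟨⟨fun _ => default, ∅, ∅, ∅⟩⟩

namespace Hdlr

/-- The fields are elements of the required types. -/
def Valid (H : (PER → PER) → PER → PER) (h : Hdlr) : Prop :=
  (retP h.M).IsClass h.ret ∧ (bindP h.M).IsClass h.bind ∧ (transP (H h.M) h.M).IsClass h.malg

/-- Realizers of a handler are triples of realizers of `ret`, `bind`, `malg`; the field `M` is
realized by everything. -/
def reals (h : Hdlr) : Set Alg :=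
  {n | n.fst ∈ h.ret ∧ n.snd.fst ∈ h.bind ∧ n.snd.snd ∈ h.malg}

/-- The assembly of handlers of a higher-order functor with object part `H`. -/
def asm (H : (PER → PER) → PER → PER) : Asm where
  Carrier := {h : Hdlr // h.Valid H}
  real n h := n ∈ h.1.reals
  exists_real := by
    rintro ⟨h, ⟨r, hr, er⟩, ⟨b, hb, eb⟩, ⟨m, hm, em⟩⟩
    obtain ⟨n', h1, h2⟩ := Alg.exists_pair b m
    obtain ⟨n, h3, h4⟩ := Alg.exists_pair r n'
    refine ⟨n, ?_, ?_, ?_⟩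
    · rw [h3, er]; exact hr
    · rw [h4, h1, eb]; exact hb
    · rw [h4, h2, em]; exact hm

/-- `ret A` -/
def retAt (h : Hdlr) (A : PER) : Set Alg := appP (.arr A (h.M A)) h.ret

end Hdlr

/-- `bind A B m k` for a raw monad `M` with bind `b`. -/
def bindC (M : PER → PER) (b : Set Alg) (A B : PER) (m k : Set Alg) : Set Alg :=
  appC (M B)
    (appC (.arr (.arr A (M B)) (M B))
      (appP (.arr (M A) (.arr (.arr A (M B)) (M B)))
        (appP (allP fun β => .arr (M A) (.arr (.arr A (M β)) (M β))) b)) m) k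

/-- `λ α β f m. bind α β m (λ a. ret β (f a))` -/
def fctC (M : PER → PER) (r b : Set Alg) : Set Alg :=
  lamP fun α => lamP fun β => lamC (PER.arr α β).asm fun f => lamC (M α).asm fun m =>
    bindC M b α β m.1
      (lamC α.asm fun a => appC (M β) (appP (.arr β (M β)) r) (appC β f.1 a.1))

section Computations

variable (H : (PER → PER) → PER → PER)

/-- `co H A = (h : Handler H) → (B : P) → (A → h B) → h B`. -/
def coP (A : PER) : PER :=
  .pi (Hdlr.asm H) fun h => allP fun B => .arr (.arr A (h.1.M B)) (h.1.M B)

/-- The computation `λ h B r. s h B r`. -/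
def coLam (A : PER) (s : Hdlr → PER → Set Alg → Set Alg) : Set Alg :=
  lamC (Hdlr.asm H) fun h => lamP fun B => lamC (PER.arr A (h.1.M B)).asm fun r => s h.1 B r.1

/-- `c h B r` -/
def coApp (A : PER) (c : Set Alg) (h : Hdlr) (B : PER) (r : Set Alg) : Set Alg :=
  appC (h.M B)
    (appP (.arr (.arr A (h.M B)) (h.M B))
      (appC (allP fun B => .arr (.arr A (h.M B)) (h.M B)) c h.reals)) r

/-- `val a = λ h B r. r a` -/
def valC (A : PER) (a : Set Alg) : Set Alg := coLam H A fun h B r => appC (h.M B) r a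

/-- `let-in c k = λ h C r. c h C (λ a. k a h C r)` -/
def letC (A B : PER) (c : Set Alg) (k : Set Alg → Set Alg) : Set Alg :=
  coLam H B fun h C r => coApp A c h C (lamC A.asm fun a => coApp B (k a.1) h C r)

/-- `hdl h c = c h A h.ret` -/
def hdlC (A : PER) (h : Hdlr) (c : Set Alg) : Set Alg := coApp A c h A (h.retAt A)

/-- The unit and bind of the raw monad of thunks, thunks being computations. -/
def thRetC : Set Alg := lamP fun α => lamC α.asm fun x => valC H α x.1

def thBindC : Set Alg :=
  lamP fun α => lamP fun β => lamC (coP H α).asm fun m => lamC (PER.arr α (coP H β)).asm fun k =>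
    letC H α β m.1 fun a => appC (coP H β) k.1 a

/-- `op p k = λ h C r. h.bind A C (h.malg A (H.hmap T h (λ α c. hdl h c) A p)) (λ a. k a h C r)` -/
def opC (hmap : (PER → PER) → Set Alg → (PER → PER) → Set Alg → Set Alg → Set Alg)
    (A B : PER) (p : Set Alg) (k : Set Alg → Set Alg) : Set Alg :=
  coLam H B fun h C r =>
    let T := coP H
    let hm := hmap T (fctC T (thRetC H) (thBindC H)) h.M (fctC h.M h.ret h.bind)
      (lamP fun α => lamC (T α).asm fun c => hdlC α h c.1)
    let p' := appC (H h.M A) (appP (.arr (H T A) (H h.M A)) hm) p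
    bindC h.M h.bind A C (appC (h.M A) (appP (.arr (H h.M A) (h.M A)) h.malg) p')
      (lamC A.asm fun a => coApp B (k a.1) h C r)

end Computations

/-! # The realizability model of the calculus -/

open FHa

/-- Elements of kinds.  As assemblies these carry the trivial realizability relation. -/
def KSem : Kd → Type
  | .ty => PER
  | .arr k l => KSem k → KSem l

/-- A default element, never reached on well-typed expressions. -/
def KSem.dflt : (k : Kd) → KSem k
  | .ty => (default : PER)
  | .arr _ l => fun _ => KSem.dflt l

/-- Denotations of expressions: elements of kinds; elements of types, given by their sets of
realizers; raw higher-order functors; handlers. -/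
inductive Val : Type
  | el (k : Kd) (x : KSem k)
  | cl (C : Set Alg)
  | hf (obj : (PER → PER) → PER → PER) (hfmap : (PER → PER) → Set Alg → Set Alg)
      (hmap : (PER → PER) → Set Alg → (PER → PER) → Set Alg → Set Alg → Set Alg)
  | hd (h : Hdlr)

namespace Val

def toEl (k : Kd) : Val → KSem k
  | el l x => if h : l = k then h ▸ x else KSem.dflt k
  | _ => KSem.dflt k

def toTy (v : Val) : PER := v.toEl .ty

def toCl : Val → Set Alg
  | cl C => C
  | _ => ∅

def obj : Val → (PER → PER) → PER → PER
  | hf o _ _ => o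
  | _ => default

def hmap : Val → (PER → PER) → Set Alg → (PER → PER) → Set Alg → Set Alg → Set Alg
  | hf _ _ m => m
  | _ => default

def toHd : Val → Hdlr
  | hd h => h
  | _ => default

end Val

/-- Environments, and their extension. -/
abbrev Env : Type := ℕ → Val

def Env.cons (v : Val) (ρ : Env) : Env
  | 0 => v
  | n + 1 => ρ n

def ofTy (A : PER) : Val := .el .ty A

def ofEfty (F : PER → PER) : Val := .el .efty F

/-- The interpretation of expressions in the realizability model. -/
def sem : Ex → Env → Val
  | .var i, ρ => ρ i
  | .klam k l F, ρ => .el (.arr k l) fun x => (sem F (ρ.cons (.el k x))).toEl l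
  | .kapp k l F A, ρ => .el l ((sem F ρ).toEl (.arr k l) ((sem A ρ).toEl k))
  | .unit, _ => ofTy .one
  | .bool, _ => ofTy .two
  | .fn A B, ρ => ofTy (.arr (sem A ρ).toTy (sem B ρ).toTy)
  | .all k A, ρ => ofTy (.pi (.codisc (KSem k)) fun x => (sem A (ρ.cons (.el k x))).toTy)
  | .th H A, ρ => ofTy (coP (sem H ρ).obj (sem A ρ).toTy)
  | .hfun o f m, ρ => .hf ((sem o ρ).toEl .htyco)
      (fun F φ => (sem f ((ρ.cons (ofEfty F)).cons (.cl φ))).toCl)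
      (fun F φ G γ τ => (sem m (((((ρ.cons (ofEfty F)).cons (.cl φ)).cons
        (ofEfty G)).cons (.cl γ)).cons (.cl τ))).toCl)
  | .hdlr M r b m, ρ => .hd ⟨(sem M ρ).toEl .efty, (sem r ρ).toCl, (sem b ρ).toCl, (sem m ρ).toCl⟩
  | .star, _ => .cl Set.univ
  | .tt, _ => .cl {Alg.church true}
  | .ff, _ => .cl {Alg.church false}
  | .lam A _ t, ρ => .cl (lamC (sem A ρ).toTy.asm fun x => (sem t (ρ.cons (.cl x.1))).toCl)
  | .app _ B t u, ρ => .cl (appC (sem B ρ).toTy (sem t ρ).toCl (sem u ρ).toCl)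
  | .tlam k _ t, ρ => .cl (lamC (.codisc (KSem k)) fun x => (sem t (ρ.cons (.el k x))).toCl)
  | .tapp k A t F, ρ =>
      .cl (appP (sem A (ρ.cons (.el k ((sem F ρ).toEl k)))).toTy (sem t ρ).toCl)
  | .down _ _ c, ρ => .cl (sem c ρ).toCl
  | .hdl _ A h c, ρ => .cl (hdlC (sem A ρ).toTy (sem h ρ).toHd (sem c ρ).toCl)
  | .up _ _ t, ρ => .cl (sem t ρ).toCl
  | .val H A a, ρ => .cl (valC (sem H ρ).obj (sem A ρ).toTy (sem a ρ).toCl)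
  | .letin H A B c k, ρ => .cl (letC (sem H ρ).obj (sem A ρ).toTy (sem B ρ).toTy (sem c ρ).toCl
      fun a => (sem k (ρ.cons (.cl a))).toCl)
  | .op H A B p k, ρ => .cl (opC (sem H ρ).obj (sem H ρ).hmap (sem A ρ).toTy (sem B ρ).toTy
      (sem p ρ).toCl fun a => (sem k (ρ.cons (.cl a))).toCl)

/-- The interpretation of a closed term of type `bool` (the environment is irrelevant). -/
def semBool (t : ClosedBool) : Set Alg := (sem t.1 fun _ => .cl ∅).toCl

end Rz

/-! The extracted term is the erasure `Rz.erase`: types and elements of kinds become the identity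
combinator, type abstraction becomes a dummy abstraction, and computations become
continuation-passing functions taking a handler, a dummy type and a continuation. The heart of the
proof is the fundamental lemma of realizability, `Rz.soundness`. By induction on a derivation of `Γ
⊢ e ≡ e' : J`, in every environment realized by `g`, the expressions `e` and `e'` denote the same
element of `J`, and their erasures evaluated at `g` both realize it. Typing is the reflexive
instance of equality, so one induction shows both that denotations lie where they should and that
the equations hold.

An element of a PER is its set of realizers, hence is determined by any one of them
(`PER.Real.unique`). Equality of two denotations is therefore proved by exhibiting a common
realizer. The algebra validates β only; the erasures of the two sides of an η-law or of a `let`-law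
need not be β-equal. They are nevertheless related, because product PERs compare realizers through
their values on realized arguments (`PER.arr_ext`, `co_ext`).

The delicate rule is handling of an operation. A computation is a function quantified over all
handlers, so `op` can feed the given handler to the thunks inside its parameter without any
recursion, and the law amounts to unfolding `op` at that handler. The functor of thunks built into
the combinator `opT` and the erasure of its syntactic counterpart may be different λ-terms, but they
realize the same element, and `hmap` respects this (`hdl_op_elem`).

For a closed term of type `bool`, being realized in `two` says that the class of the erasure is that
of a Church Boolean. Church–Rosser turns this β-equivalence into reduction, as Church Booleans are
normal. Judgementally equal terms denote one element, which is the class of a single Church Boolean.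
A separate induction shows that erasures have no free variables beyond the context. -/

namespace LC

namespace Tm

/-! ### Renaming and substitution -/

/-- Extension of a substitution by the value of variable `0`. -/
def scons (a : Tm) (σ : ℕ → Tm) : ℕ → Tm
  | 0 => a
  | n + 1 => σ n

theorem liftR_comp (ξ ζ : ℕ → ℕ) : liftR ζ ∘ liftR ξ = liftR (ζ ∘ ξ) := by
  funext i; cases i <;> rfl

theorem liftS_comp_liftR (ξ : ℕ → ℕ) (σ : ℕ → Tm) : liftS σ ∘ liftR ξ = liftS (σ ∘ ξ) := by
  funext i; cases i <;> rfl

theorem rename_rename (t : Tm) : ∀ ξ ζ : ℕ → ℕ, (t.rename ξ).rename ζ = t.rename (ζ ∘ ξ) := by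
  induction t with
  | var i => intro ξ ζ; rfl
  | app t u iht ihu => intro ξ ζ; simp [rename, iht, ihu]
  | lam t ih => intro ξ ζ; simp [rename, ih, liftR_comp]

theorem subst_rename (t : Tm) :
    ∀ (ξ : ℕ → ℕ) (σ : ℕ → Tm), (t.rename ξ).subst σ = t.subst (σ ∘ ξ) := by
  induction t with
  | var i => intro ξ σ; rfl
  | app t u iht ihu => intro ξ σ; simp [rename, subst, iht, ihu]
  | lam t ih => intro ξ σ; simp [rename, subst, ih, liftS_comp_liftR]

theorem rename_subst (t : Tm) : ∀ (σ : ℕ → Tm) (ξ : ℕ → ℕ),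
    (t.subst σ).rename ξ = t.subst fun i => (σ i).rename ξ := by
  induction t with
  | var i => intro σ ξ; rfl
  | app t u iht ihu => intro σ ξ; simp [rename, subst, iht, ihu]
  | lam t ih =>
    intro σ ξ
    simp only [rename, subst, ih]
    congr 2
    funext i
    cases i with
    | zero => rfl
    | succ i => simp only [liftS, rename_rename]; rfl

theorem subst_subst (t : Tm) : ∀ σ τ : ℕ → Tm,
    (t.subst σ).subst τ = t.subst fun i => (σ i).subst τ := by
  induction t with
  | var i => intro σ τ; rfl
  | app t u iht ihu => intro σ τ; simp [subst, iht, ihu]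
  | lam t ih =>
    intro σ τ
    simp only [subst, ih]
    congr 2
    funext i
    cases i with
    | zero => rfl
    | succ i => simp only [liftS, subst_rename, rename_subst]; rfl

theorem liftS_var : liftS var = var := by
  funext i; cases i <;> rfl

theorem subst_var (t : Tm) : t.subst var = t := by
  induction t with
  | var i => rfl
  | app t u iht ihu => simp [subst, iht, ihu]
  | lam t ih => simp [subst, liftS_var, ih]

/-- Contracting a β-redex after substituting under its binder amounts to extending the substitution.
This is what makes application of an evaluated abstraction an environment extension. -/
theorem subst_liftS_single (t : Tm) (σ : ℕ → Tm) (u : Tm) :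
    (t.subst (liftS σ)).subst (single u) = t.subst (scons u σ) := by
  rw [subst_subst]
  congr 1
  funext i
  cases i with
  | zero => rfl
  | succ i =>
    simp only [liftS, subst_rename, scons]
    exact subst_var _

theorem subst_single_subst (t u : Tm) (σ : ℕ → Tm) :
    (t.subst (single u)).subst σ = (t.subst (liftS σ)).subst (single (u.subst σ)) := by
  rw [subst_liftS_single, subst_subst]
  congr 1
  funext i
  cases i <;> rfl

theorem subst_single_rename (t u : Tm) (ξ : ℕ → ℕ) :
    (t.subst (single u)).rename ξ = (t.rename (liftR ξ)).subst (single (u.rename ξ)) := by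
  rw [subst_rename, rename_subst]
  congr 1
  funext i
  cases i <;> rfl

theorem ClosedAt.rename {t : Tm} : ∀ {n m : ℕ} {ξ : ℕ → ℕ},
    t.ClosedAt n → (∀ i < n, ξ i < m) → (t.rename ξ).ClosedAt m := by
  induction t with
  | var i => intro n m ξ h hξ; exact hξ i h
  | app t u iht ihu => intro n m ξ h hξ; exact ⟨iht h.1 hξ, ihu h.2 hξ⟩
  | lam t ih =>
    intro n m ξ h hξ
    refine ih (n := n + 1) (m := m + 1) h fun i hi => ?_
    cases i with
    | zero => exact Nat.succ_pos m
    | succ i => exact Nat.succ_lt_succ (hξ i (Nat.lt_of_succ_lt_succ hi))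

theorem ClosedAt.subst {t : Tm} : ∀ {n m : ℕ} {σ : ℕ → Tm}, t.ClosedAt n →
    (∀ i < n, (σ i).ClosedAt m) → (t.subst σ).ClosedAt m := by
  induction t with
  | var i => intro n m σ h hσ; exact hσ i h
  | app t u iht ihu => intro n m σ h hσ; exact ⟨iht h.1 hσ, ihu h.2 hσ⟩
  | lam t ih =>
    intro n m σ h hσ
    refine ih (n := n + 1) (m := m + 1) h fun i hi => ?_
    cases i with
    | zero => exact Nat.succ_pos m
    | succ i =>
      exact (hσ i (Nat.lt_of_succ_lt_succ hi)).rename fun _ h => Nat.succ_lt_succ h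

/-- A term has finitely many free variables, so it is closed at some bound `n`, and below `n` every
variable is replaced by a closed term. -/
theorem closed_subst (t : Tm) {σ : ℕ → Tm} (hσ : ∀ i, (σ i).Closed) : (t.subst σ).Closed := by
  have bound : ∀ t : Tm, ∃ n, t.ClosedAt n := by
    intro t
    induction t with
    | var i => exact ⟨i + 1, Nat.lt_succ_self i⟩
    | app t u iht ihu =>
      obtain ⟨n, hn⟩ := iht
      obtain ⟨m, hm⟩ := ihu
      exact ⟨max n m, hn.mono (le_max_left _ _), hm.mono (le_max_right _ _)⟩
    | lam t ih =>
      obtain ⟨n, hn⟩ := ih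
      exact ⟨n, hn.mono (n := n) (m := n + 1) (Nat.le_succ n)⟩
  obtain ⟨n, hn⟩ := bound t
  exact hn.subst fun i _ => hσ i

/-! ### Compatibility of beta-equivalence with renaming and substitution -/

theorem Step.rename {t u : Tm} (h : Step t u) : ∀ ξ, Step (t.rename ξ) (u.rename ξ) := by
  induction h with
  | beta t u => intro ξ; rw [subst_single_rename]; exact .beta _ _
  | appL _ _ ih => intro ξ; exact .appL _ (ih ξ)
  | appR _ _ ih => intro ξ; exact .appR _ (ih ξ)
  | lam _ ih => intro ξ; exact .lam (ih _)

theorem BetaEq.rename {t u : Tm} (h : BetaEq t u) (ξ : ℕ → ℕ) :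
    BetaEq (t.rename ξ) (u.rename ξ) := by
  induction h with
  | rel _ _ h => exact .rel _ _ (h.rename ξ)
  | refl _ => exact .refl _
  | symm _ _ _ ih => exact .symm _ _ ih
  | trans _ _ _ _ _ ih ih' => exact .trans _ _ _ ih ih'

theorem BetaEq.lam {t u : Tm} (h : BetaEq t u) : BetaEq (.lam t) (.lam u) := by
  induction h with
  | rel _ _ h => exact .rel _ _ (.lam h)
  | refl _ => exact .refl _
  | symm _ _ _ ih => exact .symm _ _ ih
  | trans _ _ _ _ _ ih ih' => exact .trans _ _ _ ih ih'

/-- Evaluation substitutes chosen representatives of β-classes; this lemma makes the choice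
immaterial. -/
theorem BetaEq.subst_congr (t : Tm) : ∀ {σ τ : ℕ → Tm}, (∀ i, BetaEq (σ i) (τ i)) →
    BetaEq (t.subst σ) (t.subst τ) := by
  induction t with
  | var i => intro σ τ h; exact h i
  | app t u iht ihu => intro σ τ h; exact (iht h).app (ihu h)
  | lam t ih =>
    intro σ τ h
    refine (ih fun i => ?_).lam
    cases i with
    | zero => exact .refl _
    | succ i => exact (h i).rename _

/-! ### Confluence -/

/-- Parallel reduction. -/
inductive Par : Tm → Tm → Prop
  | var (i : ℕ) : Par (.var i) (.var i)
  | app {t t' u u' : Tm} : Par t t' → Par u u' → Par (.app t u) (.app t' u')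
  | lam {t t' : Tm} : Par t t' → Par (.lam t) (.lam t')
  | beta {t t' u u' : Tm} : Par t t' → Par u u' →
      Par (.app (.lam t) u) (t'.subst (single u'))

theorem Par.refl (t : Tm) : Par t t := by
  induction t with
  | var i => exact .var i
  | app t u iht ihu => exact .app iht ihu
  | lam t ih => exact .lam ih

theorem Step.par {t u : Tm} (h : Step t u) : Par t u := by
  induction h with
  | beta t u => exact .beta (.refl t) (.refl u)
  | appL u _ ih => exact .app ih (.refl u)
  | appR t _ ih => exact .app (.refl t) ih
  | lam _ ih => exact .lam ih

theorem steps_lam {t t' : Tm} (h : Relation.ReflTransGen Step t t') :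
    Relation.ReflTransGen Step (.lam t) (.lam t') := by
  induction h with
  | refl => exact .refl
  | tail _ h ih => exact ih.tail (.lam h)

theorem steps_app {t t' u u' : Tm} (h : Relation.ReflTransGen Step t t')
    (h' : Relation.ReflTransGen Step u u') :
    Relation.ReflTransGen Step (.app t u) (.app t' u') := by
  induction h with
  | refl =>
    induction h' with
    | refl => exact .refl
    | tail _ h ih => exact ih.tail (.appR _ h)
  | tail _ h ih => exact ih.tail (.appL _ h)

theorem Par.steps {t u : Tm} (h : Par t u) : Relation.ReflTransGen Step t u := by
  induction h with
  | var i => exact .refl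
  | app _ _ ih ih' => exact steps_app ih ih'
  | lam _ ih => exact steps_lam ih
  | beta _ _ ih ih' => exact (steps_app (steps_lam ih) ih').tail (.beta _ _)

theorem Par.rename {t u : Tm} (h : Par t u) : ∀ ξ, Par (t.rename ξ) (u.rename ξ) := by
  induction h with
  | var i => intro ξ; exact .var _
  | app _ _ ih ih' => intro ξ; exact .app (ih ξ) (ih' ξ)
  | lam _ ih => intro ξ; exact .lam (ih _)
  | beta _ _ ih ih' => intro ξ; rw [subst_single_rename]; exact .beta (ih _) (ih' ξ)

theorem Par.liftS {σ τ : ℕ → Tm} (h : ∀ i, Par (σ i) (τ i)) (i : ℕ) :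
    Par (liftS σ i) (liftS τ i) := by
  cases i with
  | zero => exact .var 0
  | succ i => exact (h i).rename _

theorem Par.subst {t u : Tm} (h : Par t u) : ∀ {σ τ : ℕ → Tm}, (∀ i, Par (σ i) (τ i)) →
    Par (t.subst σ) (u.subst τ) := by
  induction h with
  | var i => intro σ τ hσ; exact hσ i
  | app _ _ ih ih' => intro σ τ hσ; exact .app (ih hσ) (ih' hσ)
  | lam _ ih => intro σ τ hσ; exact .lam (ih (Par.liftS hσ))
  | beta _ _ ih ih' =>
    intro σ τ hσ
    rw [subst_single_subst]
    exact .beta (ih (Par.liftS hσ)) (ih' hσ)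

theorem Par.single {t u : Tm} (h : Par t u) (i : ℕ) : Par (single t i) (single u i) := by
  cases i with
  | zero => exact h
  | succ i => exact .var i

/-- The complete development of a term. -/
def develop : Tm → Tm
  | var i => var i
  | app (lam t) u => t.develop.subst (single u.develop)
  | app (var i) u => app (var i) u.develop
  | app (app t t') u => app (app t t').develop u.develop
  | lam t => lam t.develop

/-- Takahashi's triangle property: a parallel step contracts some of the redexes present in `t`, and
contracting the remaining ones leads to the complete development. The diamond property follows,
since the target depends on `t` alone. -/
theorem Par.develop {t u : Tm} (h : Par t u) : Par u t.develop := by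
  induction h with
  | var i => exact .var i
  | @app t t' u u' h _ ih ih' =>
    cases t with
    | var i => exact .app ih ih'
    | app _ _ => exact .app ih ih'
    | lam t =>
      -- Here the left factor was an abstraction whose redex was not contracted; the development
      -- contracts it, so the reduct catches up by a β-step.
      cases h with
      | lam h => cases ih with | lam ih => exact .beta ih ih'
  | lam _ ih => exact .lam ih
  | beta _ _ ih ih' => exact ih.subst ih'.single

/-- Church–Rosser. Single steps and parallel steps generate the same reductions, and parallel
reduction has the diamond property. -/
theorem BetaEq.join {t u : Tm} (h : BetaEq t u) :
    Relation.Join (Relation.ReflTransGen Step) t u := by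
  have confluent : ∀ {a b c : Tm}, Relation.ReflTransGen Par a b →
      Relation.ReflTransGen Par a c → Relation.Join (Relation.ReflTransGen Par) b c :=
    fun hb hc => Relation.church_rosser
      (fun a b c hb hc => ⟨a.develop, .single hb.develop, .single hc.develop⟩) hb hc
  have steps : ∀ {a b : Tm}, Relation.ReflTransGen Par a b → Relation.ReflTransGen Step a b := by
    intro a b h
    induction h with
    | refl => exact .refl
    | tail _ h ih => exact ih.trans h.steps
  suffices Relation.Join (Relation.ReflTransGen Par) t u by
    obtain ⟨v, hv, hv'⟩ := this
    exact ⟨v, steps hv, steps hv'⟩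
  induction h with
  | rel _ _ h => exact ⟨_, .single h.par, .refl⟩
  | refl _ => exact ⟨_, .refl, .refl⟩
  | symm _ _ _ ih => obtain ⟨v, hv, hv'⟩ := ih; exact ⟨v, hv', hv⟩
  | trans _ _ _ _ _ ih ih' =>
    obtain ⟨v, hv, hv'⟩ := ih
    obtain ⟨w, hw, hw'⟩ := ih'
    obtain ⟨x, hx, hx'⟩ := confluent hv' hw
    exact ⟨x, hv.trans hx, hw'.trans hx'⟩

/-- A common reduct of `t` and a normal form `v` can only be `v` itself. -/
theorem BetaEq.normalisesTo {t v : Tm} (h : BetaEq t v) (hv : Normal v) : t.NormalisesTo v := by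
  obtain ⟨w, ht, hw⟩ := h.join
  rcases hw.cases_head with rfl | ⟨u, hu, _⟩
  · exact ⟨ht, hv⟩
  · exact absurd hu (hv u)

theorem church_normal (b : Bool) : Normal (church b) := by
  intro u h
  cases b <;> cases h with | lam h => cases h with | lam h => cases h

end Tm

/-! ### Interpretation of open lambda-terms in the combinatory algebra -/

namespace Alg

/-- Extension of an environment. -/
def cons (n : Alg) (g : ℕ → Alg) : ℕ → Alg
  | 0 => n
  | i + 1 => g i

/-- The value of a lambda-term at an assignment of elements of the algebra to its variables. -/
noncomputable def eval (t : Tm) (g : ℕ → Alg) : Alg :=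
  mk ⟨t.subst fun i => (Quotient.out (g i)).1, t.closed_subst fun i => (Quotient.out (g i)).2⟩

theorem mk_out (n : Alg) : mk (Quotient.out n) = n := Quotient.out_eq n

@[simp] theorem eval_var (i : ℕ) (g : ℕ → Alg) : eval (.var i) g = g i := mk_out (g i)

@[simp] theorem eval_app (t u : Tm) (g : ℕ → Alg) :
    eval (.app t u) g = (eval t g).app (eval u g) := rfl

@[simp] theorem cons_zero (n : Alg) (g : ℕ → Alg) : cons n g 0 = n := rfl

@[simp] theorem cons_succ (n : Alg) (g : ℕ → Alg) (i : ℕ) : cons n g (i + 1) = g i := rfl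

-- Combinatory completeness. Once `n` is replaced by its chosen representative, the two sides differ
-- by exactly one β-step.
@[simp] theorem eval_lam_app (t : Tm) (g : ℕ → Alg) (n : Alg) :
    (eval (.lam t) g).app n = eval t (cons n g) := by
  conv_lhs => rw [← mk_out n]
  refine Quotient.sound (Relation.EqvGen.rel _ _ ?_)
  have := Tm.Step.beta (t.subst (Tm.liftS fun i => (Quotient.out (g i)).1)) (Quotient.out n).1
  rw [Tm.subst_liftS_single] at this
  have hs : Tm.scons (Quotient.out n).1 (fun i => (Quotient.out (g i)).1) =
      fun i => (Quotient.out (cons n g i)).1 := by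
    funext i; cases i <;> rfl
  rwa [hs] at this

theorem eval_rename (t : Tm) (ξ : ℕ → ℕ) (g : ℕ → Alg) :
    eval (t.rename ξ) g = eval t (g ∘ ξ) := by
  simp only [eval, Tm.subst_rename]
  rfl

theorem eval_subst (t : Tm) (σ : ℕ → Tm) (g : ℕ → Alg) :
    eval (t.subst σ) g = eval t fun i => eval (σ i) g := by
  refine Quotient.sound ?_
  change Tm.BetaEq _ _
  simp only [Tm.subst_subst]
  exact Tm.BetaEq.subst_congr t fun i =>
    Relation.EqvGen.symm _ _ (Quotient.exact (Quotient.out_eq (eval (σ i) g)))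

@[simp] theorem eval_church (b : Bool) (g : ℕ → Alg) : eval (Tm.church b) g = church b := by
  simp only [eval, church, (Tm.church_closed b).subst_eq (by simp)]

end Alg

end LC

/-! ### Realizers of elements of products, functions and basic types -/

namespace Rz

open LC

namespace PER

/-- `a` realizes the element `C` of the type `R`. -/
def Real (R : PER) (a : Alg) (C : Set Alg) : Prop := R.rel a a ∧ C = {b | R.rel a b}

variable {R S : PER} {a b f g n : Alg} {C D F N : Set Alg}

theorem Real.mem (h : R.Real a C) : a ∈ C := by rw [h.2]; exact h.1

theorem Real.isClass (h : R.Real a C) : R.IsClass C := ⟨a, h⟩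

theorem IsClass.real (h : R.IsClass C) (ha : a ∈ C) : R.Real a C := by
  obtain ⟨c, hc, rfl⟩ := h
  refine ⟨R.trans (R.symm ha) ha, Set.ext fun b => ?_⟩
  exact ⟨fun hb => R.trans (R.symm ha) hb, fun hb => R.trans ha hb⟩

theorem Real.of_mem (h : R.Real a C) (hb : b ∈ C) : R.Real b C := h.isClass.real hb

theorem Real.rel (h : R.Real a C) (h' : R.Real b C) : R.rel a b := by
  have := h'.mem
  rwa [h.2] at this

/-- The basic tool for proving equations in the model: a common realizer forces two elements to
coincide. -/
theorem Real.unique (h : R.Real a C) (h' : R.Real a D) : C = D := h.2.trans h'.2.symm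

/-- All realizers of `x` are sent into the one class `s x`, so `f` is related to itself; and `g` is
related to `f` exactly when it also sends realizers of `x` into `s x`. -/
theorem pi_lam {X : Asm} {S : X.Carrier → PER} {s : X.Carrier → Set Alg}
    (h : ∀ x n, X.real n x → (S x).Real (f.app n) (s x)) : (pi X S).Real f (lamC X s) := by
  refine ⟨fun x n m hn hm => (h x n hn).rel (h x m hm), Set.ext fun g => ?_⟩
  constructor
  · intro hg x n m hn hm
    exact (h x n hn).rel ((h x n hn).of_mem (hg x m hm))
  · intro hg x n hn
    rw [(h x n hn).2]
    exact hg x n n hn hn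

/-- `N` need not be the set of all realizers of `x`; a set of realizers containing `n` suffices.
This covers classes, handlers, and the set `Set.univ` used for type arguments. -/
theorem pi_app {X : Asm} {S : X.Carrier → PER} (hf : (pi X S).Real f F) (x : X.Carrier)
    (hN : ∀ m ∈ N, X.real m x) (hn : n ∈ N) : (S x).Real (f.app n) (appC (S x) F N) := by
  refine ⟨hf.1 x n n (hN n hn) (hN n hn), Set.ext fun b => ?_⟩
  constructor
  · rintro ⟨f', hf', n', hn', h⟩
    exact (S x).trans (hf.rel (hf.of_mem hf') x n n' (hN n hn) (hN n' hn')) h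
  · intro h
    exact ⟨f, hf.mem, n, hn, h⟩

theorem arr_lam {s : R.asm.Carrier → Set Alg}
    (h : ∀ (x : R.asm.Carrier) (n : Alg), R.Real n x.1 → S.Real (f.app n) (s x)) :
    (arr R S).Real f (lamC R.asm s) :=
  pi_lam fun x n hn => h x n (IsClass.real x.2 hn)

theorem arr_app (hf : (arr R S).Real f F) (hn : R.Real n N) :
    S.Real (f.app n) (appC S F N) :=
  pi_app (X := R.asm) (S := fun _ => S) hf ⟨N, hn.isClass⟩ (fun _ hm => hm) hn.mem

/-- Semantic η: the abstraction of the application map of `F` is realized by the same `f` as `F`. -/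
theorem arr_eta (hf : (arr R S).Real f F) : lamC R.asm (fun x => appC S F x.1) = F :=
  (arr_lam fun _ _ hn => arr_app hf hn).unique hf

/-- Extensionality for realizers: behaving like `F` on realized arguments is enough to realize `F`,
although `g` need not be β-equal to any given realizer of `F`. This supplies the η missing from the
algebra. -/
theorem arr_ext (hf : (arr R S).Real f F)
    (h : ∀ (x : R.asm.Carrier) (n : Alg), R.Real n x.1 → S.Real (g.app n) (appC S F x.1)) :
    (arr R S).Real g F := by
  rw [← arr_eta hf]
  exact arr_lam h

theorem all_lam {α : Type} {S : α → PER} {s : α → Set Alg}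
    (h : ∀ (x : α) (n : Alg), (S x).Real (f.app n) (s x)) :
    (pi (.codisc α) S).Real f (lamC (.codisc α) s) :=
  pi_lam (X := .codisc α) fun x n _ => h x n

theorem all_app {α : Type} {S : α → PER} (hf : (pi (.codisc α) S).Real f F) (x : α) (n : Alg) :
    (S x).Real (f.app n) (appP (S x) F) :=
  pi_app (X := .codisc α) hf x (fun _ _ => trivial) (Set.mem_univ n)

theorem all_eta {α : Type} {S : α → PER} (hf : (pi (.codisc α) S).Real f F) :
    lamC (.codisc α) (fun x => appP (S x) F) = F :=
  (all_lam fun x n => all_app hf x n).unique hf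

theorem one_real (a : Alg) : one.Real a Set.univ :=
  ⟨trivial, (Set.eq_univ_of_forall fun _ => trivial).symm⟩

theorem two_real (b : Bool) : two.Real (Alg.church b) {Alg.church b} := by
  refine ⟨⟨b, rfl, rfl⟩, Set.ext fun a => ?_⟩
  constructor
  · rintro rfl; exact ⟨b, rfl, rfl⟩
  · rintro ⟨c, h, rfl⟩; exact h.symm

end PER

open PER

/-- `∀ α β. (α ⇒ β) ⇒ F α ⇒ F β` -/
def fmapP (F : PER → PER) : PER :=
  allP fun α => allP fun β => .arr (.arr α β) (.arr (F α) (F β))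

/-! ### Realizers of raw monads, transformations and functors -/

section Monad

variable {M F G : PER → PER} {A B : PER} {b r m k t a : Alg} {Cb Cr Cm Ck Ct Ca : Set Alg}

theorem ret_real (hr : (retP M).Real r Cr) (ha : A.Real a Ca) (d : Alg) :
    (M A).Real ((r.app d).app a) (appC (M A) (appP (.arr A (M A)) Cr) Ca) :=
  arr_app (all_app hr A d) ha

theorem trans_real (ht : (transP F G).Real t Ct) (ha : (F A).Real a Ca) (d : Alg) :
    (G A).Real ((t.app d).app a) (appC (G A) (appP (.arr (F A) (G A)) Ct) Ca) :=
  arr_app (all_app ht A d) ha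

theorem bind_real (hb : (bindP M).Real b Cb) (hm : (M A).Real m Cm)
    (hk : (arr A (M B)).Real k Ck) (d d' : Alg) :
    (M B).Real ((((b.app d).app d').app m).app k) (bindC M Cb A B Cm Ck) :=
  arr_app (arr_app (all_app (all_app hb A d) B d') hm) hk

/-- Only the applicative behaviour of `f` is prescribed, and the inner continuation only up to its
values. Thus the combinator `fctT` and the erasure of the syntactic functor fall under one
statement. The elements `d₁`, `d₂`, `d₃` stand in for erased type arguments. -/
theorem fct_real {f d₁ d₂ d₃ : Alg} (hr : (retP M).Real r Cr) (hb : (bindP M).Real b Cb)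
    (hf : ∀ e e' x m : Alg, ∃ k : Alg,
      (((f.app e).app e').app x).app m = (((b.app d₁).app d₂).app m).app k ∧
        ∀ a, k.app a = (r.app d₃).app (x.app a)) :
    (fmapP M).Real f (fctC M Cr Cb) := by
  refine all_lam fun α e => all_lam fun β e' => arr_lam fun x nx hx => arr_lam fun m nm hm => ?_
  obtain ⟨k, h, hk⟩ := hf e e' nx nm
  rw [h]
  refine bind_real hb hm (arr_lam fun a na ha => ?_) _ _
  rw [hk]
  exact ret_real hr (arr_app hx ha) _

end Monad

/-- `n` realizes the handler `h`. -/
def Hdlr.Real (H : (PER → PER) → PER → PER) (n : Alg) (h : Hdlr) : Prop :=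
  (retP h.M).Real n.fst h.ret ∧ (bindP h.M).Real n.snd.fst h.bind ∧
    (transP (H h.M) h.M).Real n.snd.snd h.malg

/-! ### Realizers of computations, thunks and operations -/

section Computations

variable {H : (PER → PER) → PER → PER} {A B : PER} {h : Hdlr} {f g c n m a : Alg}
  {F C r Ca : Set Alg}

theorem co_lam {s : Hdlr → PER → Set Alg → Set Alg}
    (hs : ∀ (h : Hdlr) (n : Alg) (B : PER) (d : Alg) (r : Set Alg) (m : Alg), h.Real H n →
      (arr A (h.M B)).Real m r → (h.M B).Real (((f.app n).app d).app m) (s h B r)) :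
    (coP H A).Real f (coLam H A s) :=
  pi_lam (X := Hdlr.asm H) fun h n hn => all_lam fun B d => arr_lam fun r m hm =>
    hs h.1 n B d r.1 m ⟨h.2.1.real hn.1, h.2.2.1.real hn.2.1, h.2.2.2.real hn.2.2⟩ hm

theorem co_app (hc : (coP H A).Real c C) (hh : h.Real H n) (hm : (arr A (h.M B)).Real m r)
    (d : Alg) : (h.M B).Real (((c.app n).app d).app m) (coApp A C h B r) :=
  arr_app (all_app (pi_app (X := Hdlr.asm H) hc
    ⟨h, hh.1.isClass, hh.2.1.isClass, hh.2.2.isClass⟩ (fun _ hm => hm)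
    ⟨hh.1.mem, hh.2.1.mem, hh.2.2.mem⟩) B d) hm

/-- Extensionality for computations: `g` realizes `F` if, at every handler and continuation, it
produces a realizer of the same element as a known realizer `f` of `F`. The `let`-laws are all
proved through this. -/
theorem co_ext (hf : (coP H A).Real f F)
    (hg : ∀ (h : Hdlr) (n : Alg) (B : PER) (d : Alg) (r : Set Alg) (m : Alg), h.Real H n →
      (arr A (h.M B)).Real m r → ∃ X, (h.M B).Real (((f.app n).app d).app m) X ∧
        (h.M B).Real (((g.app n).app d).app m) X) :
    (coP H A).Real g F := by
  have : coLam H A (fun h B r => coApp A F h B r) = F :=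
    (co_lam fun _ _ _ d _ _ hh hm => co_app hf hh hm d).unique hf
  rw [← this]
  refine co_lam fun h n B d r m hh hm => ?_
  obtain ⟨X, hX, hX'⟩ := hg h n B d r m hh hm
  rwa [(co_app hf hh hm d).unique hX]

theorem val_real (ha : A.Real a Ca) (hf : ∀ n d m : Alg, ((f.app n).app d).app m = m.app a) :
    (coP H A).Real f (valC H A Ca) := by
  refine co_lam fun h n B d r m _ hm => ?_
  rw [hf]
  exact arr_app hm ha

/-- The continuation that a `let` or an operation passes on: run the rest `k a` with the current
handler and the outer continuation. -/
theorem cont_real {k : Alg → Alg} {l : Alg} {K : Set Alg → Set Alg}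
    (hk : ∀ n N, A.Real n N → (coP H B).Real (k n) (K N)) {D : PER}
    (hh : h.Real H n) (hm : (arr B (h.M D)).Real m r) (d : Alg)
    (hl : ∀ a, l.app a = (((k a).app n).app d).app m) :
    (arr A (h.M D)).Real l (lamC A.asm fun a => coApp B (K a.1) h D r) := by
  refine arr_lam fun x na ha => ?_
  rw [hl]
  exact co_app (hk na x.1 ha) hh hm _

theorem let_real {k : Alg → Alg} {K : Set Alg → Set Alg} (hc : (coP H A).Real c C)
    (hk : ∀ n N, A.Real n N → (coP H B).Real (k n) (K N))
    (hf : ∀ n d m : Alg, ∃ l : Alg, ((f.app n).app d).app m = ((c.app n).app d).app l ∧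
      ∀ a, l.app a = (((k a).app n).app d).app m) :
    (coP H B).Real f (letC H A B C K) := by
  refine co_lam fun h n D d r m hh hm => ?_
  obtain ⟨l, h, hl⟩ := hf n d m
  rw [h]
  exact co_app hc hh (cont_real hk hh hm d hl) d

/-- Handling runs the computation with the unit of the handler as continuation; `d` and `d'` are the
erased result type, passed to the computation and to the unit. -/
theorem hdl_real (hc : (coP H A).Real c C) (hh : h.Real H n) (d d' : Alg) :
    (h.M A).Real (((c.app n).app d).app (n.fst.app d')) (hdlC A h C) :=
  co_app hc hh (all_app hh.1 A d') d

theorem thRet_real (hf : ∀ e x n d m : Alg,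
      ((((f.app e).app x).app n).app d).app m = m.app x) :
    (retP (coP H)).Real f (thRetC H) :=
  all_lam fun _ e => arr_lam fun _ nx hx => val_real hx (hf e nx)

theorem thBind_real (hf : ∀ e e' c k n d m : Alg, ∃ l : Alg,
      ((((((f.app e).app e').app c).app k).app n).app d).app m = ((c.app n).app d).app l ∧
        ∀ a, l.app a = (((k.app a).app n).app d).app m) :
    (bindP (coP H)).Real f (thBindC H) :=
  all_lam fun _ e => all_lam fun _ e' => arr_lam fun _ nm hm => arr_lam fun _ nk hk =>
    let_real (k := nk.app) hm (fun _ _ ha => arr_app hk ha) (hf e e' nm nk)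

/-- The transformation `λ α c. hdl h c`. -/
def hdlTransC (H : (PER → PER) → PER → PER) (h : Hdlr) : Set Alg :=
  lamP fun α => lamC (coP H α).asm fun c => hdlC α h c.1

theorem hdlTrans_real {d d' : Alg} (hh : h.Real H n)
    (hf : ∀ e c : Alg, (f.app e).app c = ((c.app n).app d).app (n.fst.app d')) :
    (transP (coP H) h.M).Real f (hdlTransC H h) := by
  refine all_lam fun α e => arr_lam fun x c hc => ?_
  rw [hf]
  exact hdl_real hc hh d d'

/-- `a` realizes the `hmap` component `m` of a higher-order functor with object part `o`. -/
def HfReal (o : (PER → PER) → PER → PER)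
    (m : (PER → PER) → Set Alg → (PER → PER) → Set Alg → Set Alg → Set Alg) (a : Alg) : Prop :=
  ∀ ⦃F φ nφ G γ nγ τ nτ⦄ (d d' : Alg), (fmapP F).Real nφ φ → (fmapP G).Real nγ γ →
    (transP F G).Real nτ τ →
      (transP (o F) (o G)).Real (((((a.app d).app nφ).app d').app nγ).app nτ) (m F φ G γ τ)

/-- `h.bind A B (h.malg A (τ A p)) k` -/
def opAt (H : (PER → PER) → PER → PER) (A : PER) (h : Hdlr) (B : PER) (τ p k : Set Alg) :
    Set Alg :=
  bindC h.M h.bind A B (appC (h.M A) (appP (.arr (H h.M A) (h.M A)) h.malg)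
    (appC (H h.M A) (appP (.arr (H (coP H) A) (H h.M A)) τ) p)) k

/-- A realizer of an operation at a handler: transform the parameter, apply the algebra, then bind
the continuation. Each `dᵢ` is an arbitrary argument in the place of an erased type. -/
theorem opAt_real {t p k : Alg} {τ P K : Set Alg} (hh : h.Real H n)
    (ht : (transP (H (coP H)) (H h.M)).Real t τ) (hp : (H (coP H) A).Real p P)
    (hk : (arr A (h.M B)).Real k K) (d₁ d₂ d₃ d₄ : Alg) :
    (h.M B).Real ((((n.snd.fst.app d₁).app d₂).app
      ((n.snd.snd.app d₃).app ((t.app d₄).app p))).app k) (opAt H A h B τ P K) :=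
  bind_real hh.2.1 (trans_real hh.2.2 (trans_real ht hp d₄) d₃) hk d₁ d₂

/-- The transformation `hmap T h (λ α c. hdl h c)` from `H T` to `H h`. -/
def opTransC (H : (PER → PER) → PER → PER)
    (hmap : (PER → PER) → Set Alg → (PER → PER) → Set Alg → Set Alg → Set Alg) (h : Hdlr) :
    Set Alg :=
  hmap (coP H) (fctC (coP H) (thRetC H) (thBindC H)) h.M (fctC h.M h.ret h.bind) (hdlTransC H h)

theorem opC_eq (H : (PER → PER) → PER → PER)
    (hmap : (PER → PER) → Set Alg → (PER → PER) → Set Alg → Set Alg → Set Alg)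
    (A B : PER) (p : Set Alg) (k : Set Alg → Set Alg) :
    opC H hmap A B p k = coLam H B fun h C r =>
      opAt H A h C (opTransC H hmap h) p (lamC A.asm fun a => coApp B (k a.1) h C r) := rfl

end Computations

end Rz

namespace Rz

open LC FHa

/-! ### Compositionality of the interpretation -/

theorem Env.cons_liftR (v : Val) (ρ : Env) (ξ : ℕ → ℕ) :
    (fun i => ρ.cons v (FHa.liftR ξ i)) = Env.cons v fun i => ρ (ξ i) := by
  funext i; cases i <;> rfl

/-- `lamC` at a type, for a function defined on all sets. -/
def lamA (A : PER) (t : Set Alg → Set Alg) : Set Alg := lamC A.asm fun x => t x.1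

/-- In the clause of `sem`, the domain of the body depends on the denotation of `A`. Through `lamA`
the body becomes a function on all sets, so that rewriting `A` and rewriting the body are
independent. -/
theorem sem_lam (A B t : Ex) (ρ : Env) : sem (.lam A B t) ρ =
    .cl (lamA (sem A ρ).toTy fun C => (sem t (ρ.cons (.cl C))).toCl) := rfl

theorem sem_rename (e : Ex) : ∀ (ξ : ℕ → ℕ) (ρ : Env),
    sem (e.rename ξ) ρ = sem e fun i => ρ (ξ i) := by
  induction e <;> intro ξ ρ <;> simp only [Ex.rename] <;>
    simp only [↓sem_lam, sem, Env.cons_liftR, *]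

@[simp] theorem sem_wk_one (e : Ex) (v : Val) (ρ : Env) : sem (e.wk 1) (ρ.cons v) = sem e ρ :=
  sem_rename e _ _

@[simp] theorem sem_wk_two (e : Ex) (v v' : Val) (ρ : Env) :
    sem (e.wk 2) ((ρ.cons v).cons v') = sem e ρ := sem_rename e _ _

@[simp] theorem sem_wk_three (e : Ex) (v v' w : Val) (ρ : Env) :
    sem (e.wk 3) (((ρ.cons v).cons v').cons w) = sem e ρ := sem_rename e _ _

@[simp] theorem sem_wk_four (e : Ex) (v v' w w' : Val) (ρ : Env) :
    sem (e.wk 4) ((((ρ.cons v).cons v').cons w).cons w') = sem e ρ := sem_rename e _ _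

@[simp] theorem sem_wk_five (e : Ex) (v v' w w' x : Val) (ρ : Env) :
    sem (e.wk 5) (((((ρ.cons v).cons v').cons w).cons w').cons x) = sem e ρ := sem_rename e _ _

@[simp] theorem sem_rename_liftR (e : Ex) (v v' : Val) (ρ : Env) :
    sem (e.rename (FHa.liftR (· + 1))) ((ρ.cons v).cons v') = sem e (ρ.cons v') := by
  rw [sem_rename]
  congr 1
  funext i
  cases i <;> rfl

theorem Env.cons_liftS (v : Val) (ρ : Env) (σ : ℕ → Ex) :
    (fun i => sem (Ex.liftS σ i) (ρ.cons v)) = Env.cons v fun i => sem (σ i) ρ := by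
  funext i
  cases i with
  | zero => rfl
  | succ i => exact sem_wk_one _ _ _

/-- The semantic substitution lemma; it holds for all raw expressions, because the interpretation is
total. -/
theorem sem_subst (e : Ex) : ∀ (σ : ℕ → Ex) (ρ : Env),
    sem (e.subst σ) ρ = sem e fun i => sem (σ i) ρ := by
  induction e <;> intro σ ρ <;> simp only [Ex.subst] <;>
    simp only [↓sem_lam, sem, Env.cons_liftS, *]

theorem sem_scons (a : Ex) (σ : ℕ → Ex) (ρ : Env) :
    (fun i => sem (Ex.scons a σ i) ρ) = Env.cons (sem a ρ) fun i => sem (σ i) ρ := by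
  funext i; cases i <;> rfl

@[simp] theorem sem_inst (e a : Ex) (ρ : Env) : sem (e.inst a) ρ = sem e (ρ.cons (sem a ρ)) := by
  rw [Ex.inst, sem_subst, sem_scons]; rfl

@[simp] theorem Val.toEl_el (k : Kd) (x : KSem k) : (Val.el k x).toEl k = x := by
  simp [Val.toEl]

@[simp] theorem Val.toTy_el (x : KSem .ty) : (Val.el .ty x).toTy = x := Val.toEl_el _ _

@[simp] theorem toTy_ofTy (x : PER) : (ofTy x).toTy = x := Val.toEl_el .ty x

@[simp] theorem toEl_ofTy (x : PER) : (ofTy x).toEl .ty = x := Val.toEl_el .ty x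

@[simp] theorem toEl_ofEfty (F : PER → PER) : (ofEfty F).toEl .efty = F := Val.toEl_el .efty F

@[simp] theorem Val.toCl_cl (C : Set Alg) : (Val.cl C).toCl = C := rfl

@[simp] theorem Env.cons_zero (v : Val) (ρ : Env) : ρ.cons v 0 = v := rfl

@[simp] theorem Env.cons_succ (v : Val) (ρ : Env) (i : ℕ) : ρ.cons v (i + 1) = ρ i := rfl

@[simp] theorem Env.cons_one (v : Val) (ρ : Env) : ρ.cons v 1 = ρ 0 := rfl

@[simp] theorem Env.cons_ofNat (v : Val) (ρ : Env) (i : ℕ) [i.AtLeastTwo] :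
    ρ.cons v (OfNat.ofNat i) = ρ (OfNat.ofNat i - 1) := by
  obtain ⟨j, rfl⟩ : ∃ j, i = j + 1 := ⟨i - 1, by have := Nat.AtLeastTwo.prop (n := i); omega⟩
  rfl

/-! ### Interpretation of the derived notions -/

section Derived

variable {ρ : Env} {F G M : PER → PER} {f g : Ex}

/-- The hypothesis guarantees that `f` denotes an element of the right kind, so that no default
value of `toEl` intervenes. The derived notions below use the same form of hypothesis because it
persists under weakening. -/
theorem toTy_tyapp (hf : sem f ρ = ofEfty F) (a : Ex) :
    (sem (Ex.tyapp f a) ρ).toTy = F (sem a ρ).toTy := by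
  simp only [Ex.tyapp, sem, hf, Val.toTy_el, ofEfty]
  rfl

theorem sem_happ (hf : sem f ρ = ofEfty F) (o : Ex) :
    sem (Ex.happ o f) ρ = ofEfty ((sem o ρ).toEl .htyco F) := by
  simp only [Ex.happ, sem, hf, toEl_ofEfty]
  rfl

theorem toTy_fmapTy (hf : sem f ρ = ofEfty F) : (sem (Ex.fmapTy f) ρ).toTy = fmapP F := by
  simp [Ex.fmapTy, Ex.tyapp, sem, hf]
  rfl

theorem toTy_trans (hf : sem f ρ = ofEfty F) (hg : sem g ρ = ofEfty G) :
    (sem (Ex.trans f g) ρ).toTy = transP F G := by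
  simp [Ex.trans, Ex.tyapp, sem, hf, hg]
  rfl

theorem toTy_retTy (hf : sem f ρ = ofEfty M) : (sem (Ex.retTy f) ρ).toTy = retP M := by
  simp [Ex.retTy, Ex.tyapp, sem, hf]
  rfl

theorem toTy_bindTy (hf : sem f ρ = ofEfty M) : (sem (Ex.bindTy f) ρ).toTy = bindP M := by
  simp [Ex.bindTy, Ex.bindBody, Ex.tyapp, sem, hf]
  rfl

theorem sem_thObj (H : Ex) (ρ : Env) : sem (Ex.thObj H) ρ = ofEfty (coP (sem H ρ).obj) := by
  simp [Ex.thObj, sem]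
  rfl

theorem sem_retApp (hf : sem f ρ = ofEfty M) (r A a : Ex) :
    sem (Ex.retApp f r A a) ρ = .cl (appC (M (sem A ρ).toTy)
      (appP (.arr (sem A ρ).toTy (M (sem A ρ).toTy)) (sem r ρ).toCl) (sem a ρ).toCl) := by
  simp [Ex.retApp, Ex.tyapp, sem, hf]
  rfl

theorem sem_transAt (hf : sem f ρ = ofEfty F) (hg : sem g ρ = ofEfty G) (t A : Ex) :
    sem (Ex.transAt f g t A) ρ = .cl (appP (.arr (F (sem A ρ).toTy) (G (sem A ρ).toTy))
      (sem t ρ).toCl) := by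
  simp [Ex.transAt, Ex.tyapp, sem, hf, hg]
  rfl

theorem sem_bindApp (hf : sem f ρ = ofEfty M) (b A B m k : Ex) :
    sem (Ex.bindApp f b A B m k) ρ = .cl (bindC M (sem b ρ).toCl (sem A ρ).toTy (sem B ρ).toTy
      (sem m ρ).toCl (sem k ρ).toCl) := by
  simp [Ex.bindApp, Ex.bindBody, Ex.tyapp, sem, hf]
  rfl

theorem sem_fctOfMnd (hf : sem f ρ = ofEfty M) (r b : Ex) :
    sem (Ex.fctOfMnd f r b) ρ = .cl (fctC M (sem r ρ).toCl (sem b ρ).toCl) := by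
  simp [Ex.fctOfMnd, Ex.tyapp, sem_bindApp (M := M), sem_retApp (M := M), ↓sem_lam, sem, hf]
  rfl

theorem sem_thRet (H : Ex) (ρ : Env) : sem (Ex.thRet H) ρ = .cl (thRetC (sem H ρ).obj) := by
  simp [Ex.thRet, ↓sem_lam, sem]
  rfl

theorem sem_thBind (H : Ex) (ρ : Env) : sem (Ex.thBind H) ρ = .cl (thBindC (sem H ρ).obj) := by
  simp [Ex.thBind, Ex.tyapp, ↓sem_lam, sem, sem_thObj]
  rfl

theorem sem_hdlTrans (H m h : Ex) (ρ : Env) :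
    sem (Ex.hdlTrans H m h) ρ = .cl (hdlTransC (sem H ρ).obj (sem h ρ).toHd) := by
  simp [Ex.hdlTrans, Ex.tyapp, ↓sem_lam, sem, sem_thObj]
  rfl

theorem sem_hmapAt (m f φ g γ τ : Ex) (ρ : Env) : sem (Ex.hmapAt m f φ g γ τ) ρ =
    sem m (((((ρ.cons (sem f ρ)).cons (sem φ ρ)).cons (sem g ρ)).cons (sem γ ρ)).cons
      (sem τ ρ)) := by
  simp only [Ex.hmapAt, sem_subst, sem_scons]
  rfl

end Derived

end Rz

namespace LC

/-! ### Combinators -/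

namespace Tm

/-- The identity `λ x. x`. -/
def idT : Tm := .lam (.var 0)

/-- Pairing `λ a b z. z a b`. -/
def pairT : Tm := .lam (.lam (.lam (.app (.app (.var 0) (.var 2)) (.var 1))))

def fstT (t : Tm) : Tm := .app t (church true)
def sndT (t : Tm) : Tm := .app t (church false)

/-- `λ a h C r. r a` -/
def valT : Tm := .lam (.lam (.lam (.lam (.app (.var 0) (.var 3)))))

/-- `λ c k h C r. c h C (λ a. k a h C r)` -/
def letT : Tm := .lam (.lam (.lam (.lam (.lam (.app (.app (.app (.var 4) (.var 2)) (.var 1))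
  (.lam (.app (.app (.app (.app (.var 4) (.var 0)) (.var 3)) (.var 2)) (.var 1))))))))

/-- `λ r b α β f m. b α β m (λ a. r β (f a))`, with the type arguments erased -/
def fctT : Tm := .lam (.lam (.lam (.lam (.lam (.lam
  (.app (.app (.app (.app (.var 4) idT) idT) (.var 0))
    (.lam (.app (.app (.var 6) idT) (.app (.var 2) (.var 0))))))))))

/-- `λ α c. c h C (ret C)` for a handler `h` with unit `ret`, with the type `C` erased -/
def hdlTransT (h : Tm) : Tm := .lam (.lam (.app (.app (.app (.var 0)
  ((h.rename Nat.succ).rename Nat.succ)) idT)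
  (.app (fstT ((h.rename Nat.succ).rename Nat.succ)) idT)))

/-- `λ H p k h C r. bind (malg (H thunks h (λ α c. hdl h c) p)) (λ a. k a h C r)` -/
def opT : Tm := .lam (.lam (.lam (.lam (.lam (.lam
  (.app (.app (.app (.app (fstT (sndT (.var 2))) idT) idT)
    (.app (.app (sndT (sndT (.var 2))) idT)
      (.app (.app
        (.app (.app (.app (.app (.app (.var 5) idT)
          (.app (.app fctT (.lam valT)) (.lam (.lam letT)))) idT)
          (.app (.app fctT (fstT (.var 2))) (fstT (sndT (.var 2)))))
          (hdlTransT (.var 2)))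
        idT) (.var 4))))
    (.lam (.app (.app (.app (.app (.var 4) (.var 0)) (.var 3)) (.var 2)) (.var 1)))))))))

end Tm

namespace Alg

open Tm

@[simp] theorem church_true_app (a b : Alg) : ((church true).app a).app b = a := by
  rw [← eval_church true fun _ => a]
  simp [Tm.church]

@[simp] theorem church_false_app (a b : Alg) : ((church false).app a).app b = b := by
  rw [← eval_church false fun _ => a]
  simp [Tm.church]

/-- The class of the identity. -/
def idA : Alg := mk ⟨idT, by simp [idT, Closed, ClosedAt]⟩

variable (g : ℕ → Alg)

@[simp] theorem eval_idT : eval idT g = idA := rfl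

@[simp] theorem eval_fstT (t : Tm) : eval (fstT t) g = (eval t g).fst := by
  simp [fstT, fst]

@[simp] theorem eval_sndT (t : Tm) : eval (sndT t) g = (eval t g).snd := by
  simp [sndT, snd]

@[simp] theorem pairT_fst (a b : Alg) : (((eval pairT g).app a).app b).fst = a := by
  simp [pairT, fst]

@[simp] theorem pairT_snd (a b : Alg) : (((eval pairT g).app a).app b).snd = b := by
  simp [pairT, snd]

@[simp] theorem valT_app (a n d m : Alg) :
    ((((eval valT g).app a).app n).app d).app m = m.app a := by
  simp [valT]

/-- The continuation is hidden behind an existential, since later arguments depend only on its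
values. -/
theorem letT_app (c k n d m : Alg) : ∃ l : Alg,
    (((((eval letT g).app c).app k).app n).app d).app m = ((c.app n).app d).app l ∧
      ∀ a, l.app a = (((k.app a).app n).app d).app m := by
  simp only [letT, eval_lam_app, eval_app, eval_var]
  exact ⟨_, rfl, fun a => by simp⟩

theorem fctT_app (r b e e' x m : Alg) : ∃ k : Alg,
    ((((((eval fctT g).app r).app b).app e).app e').app x).app m =
      (((b.app idA).app idA).app m).app k ∧
      ∀ a, k.app a = (r.app idA).app (x.app a) := by
  simp only [fctT, eval_lam_app, eval_app, eval_var]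
  exact ⟨_, rfl, fun a => by simp⟩

theorem hdlTransT_app (h : Tm) (e c : Alg) : ((eval (hdlTransT h) g).app e).app c =
    ((c.app (eval h g)).app idA).app ((eval h g).fst.app idA) := by
  simp [hdlTransT, eval_rename]
  rfl

/-- Unfolding of `opT` at a handler. The λ-terms `.lam valT` and `.lam (.lam letT)` are the unit and
bind of thunks with dummy type abstractions in front; `τ` is the handling transformation, `l` the
continuation, and `g'` the environment in which the inner closed combinators happen to be evaluated.
-/
theorem opT_app (H p k n d m : Alg) : ∃ (τ l : Alg) (g' : ℕ → Alg),
    ((((((eval opT g).app H).app p).app k).app n).app d).app m =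
      (((n.snd.fst.app idA).app idA).app ((n.snd.snd.app idA).app
        (((((((H.app idA).app
          (((eval fctT g').app (eval (.lam valT) g')).app (eval (.lam (.lam letT)) g'))).app
          idA).app (((eval fctT g').app n.fst).app n.snd.fst)).app τ).app idA).app p))).app l ∧
      (∀ e c, (τ.app e).app c = ((c.app n).app idA).app (n.fst.app idA)) ∧
      ∀ a, l.app a = (((k.app a).app n).app d).app m := by
  simp only [opT, eval_lam_app, eval_app, eval_var, eval_fstT, eval_sndT, eval_idT]
  exact ⟨_, _, _, rfl, fun e c => by rw [hdlTransT_app, eval_var]; rfl, fun a => by simp⟩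

end Alg

end LC

namespace Rz

open LC FHa

/-! ### Erasure -/

/-- The untyped lambda-term of an expression: types and elements of kinds are erased. -/
def erase : Ex → Tm
  | .var i => .var i
  | .klam _ _ _ => .idT
  | .kapp _ _ _ _ => .idT
  | .unit => .idT
  | .bool => .idT
  | .fn _ _ => .idT
  | .all _ _ => .idT
  | .th _ _ => .idT
  | .hfun _ _ m => .lam (.lam (.lam (.lam (.lam (erase m)))))
  | .hdlr _ r b m => .app (.app .pairT (erase r)) (.app (.app .pairT (erase b)) (erase m))
  | .star => .idT
  | .tt => .church true
  | .ff => .church false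
  | .lam _ _ t => .lam (erase t)
  | .app _ _ t u => .app (erase t) (erase u)
  | .tlam _ _ t => .lam (erase t)
  | .tapp _ _ t _ => .app (erase t) .idT
  | .down _ _ c => erase c
  | .hdl _ _ h c =>
      .app (.app (.app (erase c) (erase h)) .idT) (.app (.fstT (erase h)) .idT)
  | .up _ _ t => erase t
  | .val _ _ a => .app .valT (erase a)
  | .letin _ _ _ c k => .app (.app .letT (erase c)) (.lam (erase k))
  | .op H _ _ p k => .app (.app (.app .opT (erase H)) (erase p)) (.lam (erase k))

theorem liftR_eq (ξ : ℕ → ℕ) : FHa.liftR ξ = LC.liftR ξ := by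
  funext i; cases i <;> rfl

theorem erase_rename (e : Ex) : ∀ ξ : ℕ → ℕ, erase (e.rename ξ) = (erase e).rename ξ := by
  induction e <;> intro ξ <;> simp only [Ex.rename, erase, Tm.rename, liftR_eq, Tm.fstT, *] <;> rfl

theorem erase_liftS (σ : ℕ → Ex) :
    (fun i => erase (Ex.liftS σ i)) = Tm.liftS fun i => erase (σ i) := by
  funext i
  cases i with
  | zero => rfl
  | succ i => exact erase_rename _ _

theorem erase_subst (e : Ex) : ∀ σ : ℕ → Ex,
    erase (e.subst σ) = (erase e).subst fun i => erase (σ i) := by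
  induction e <;> intro σ <;>
    simp only [Ex.subst, erase, Tm.subst, erase_liftS, Tm.fstT, *] <;> rfl

/-- The realizer of an expression at an assignment of realizers to its variables. -/
noncomputable def rz (e : Ex) (g : ℕ → Alg) : Alg := Alg.eval (erase e) g

section

variable (e a : Ex) (n m k l x : Alg) (g : ℕ → Alg)

theorem rz_rename (ξ : ℕ → ℕ) : rz (e.rename ξ) g = rz e (g ∘ ξ) := by
  rw [rz, erase_rename, Alg.eval_rename]; rfl

@[simp] theorem rz_wk_one : rz (e.wk 1) (.cons n g) = rz e g := rz_rename e _ _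

@[simp] theorem rz_wk_two : rz (e.wk 2) (.cons n (.cons m g)) = rz e g := rz_rename e _ _

@[simp] theorem rz_wk_four : rz (e.wk 4) (.cons n (.cons m (.cons k (.cons l g)))) = rz e g :=
  rz_rename e _ _

@[simp] theorem rz_wk_five :
    rz (e.wk 5) (.cons n (.cons m (.cons k (.cons l (.cons x g))))) = rz e g :=
  rz_rename e _ _

@[simp] theorem rz_rename_liftR :
    rz (e.rename (FHa.liftR (· + 1))) (.cons n (.cons m g)) = rz e (.cons n g) := by
  rw [rz_rename]
  congr 1
  funext i
  cases i <;> rfl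

/-- Erasure and evaluation both commute with substitution, so realizers obey the same substitution
law as denotations. -/
theorem rz_subst (σ : ℕ → Ex) : rz (e.subst σ) g = rz e fun i => rz (σ i) g := by
  rw [rz, erase_subst, Alg.eval_subst]; rfl

theorem rz_scons (σ : ℕ → Ex) :
    (fun i => rz (Ex.scons a σ i) g) = Alg.cons (rz a g) fun i => rz (σ i) g := by
  funext i; cases i <;> rfl

theorem rz_fun_var : (fun i => rz (.var i) g) = g := funext fun i => Alg.eval_var i g

@[simp] theorem rz_inst : rz (e.inst a) g = rz e (.cons (rz a g) g) := by
  rw [Ex.inst, rz_subst, rz_scons, rz_fun_var]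

theorem rz_hmapAt (m f φ f' φ' τ : Ex) : rz (Ex.hmapAt m f φ f' φ' τ) g =
    rz m (.cons (rz τ g) (.cons (rz φ' g) (.cons (rz f' g) (.cons (rz φ g) (.cons (rz f g) g))))) := by
  simp only [Ex.hmapAt, rz_subst, rz_scons, rz_fun_var]

end

end Rz

namespace Rz

open LC FHa

/-! ### Realizers of expressions -/

section

variable (H A B F M o f t u a b c e h k p r : Ex) (l l' : Kd) (g : ℕ → Alg)
  (n d m x d' y z : Alg)

@[simp] theorem rz_var (i : ℕ) : rz (.var i) g = g i := Alg.eval_var i g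

@[simp] theorem rz_lam_app : (rz (.lam A B t) g).app n = rz t (.cons n g) := Alg.eval_lam_app _ _ _

@[simp] theorem rz_app : rz (.app A B t u) g = (rz t g).app (rz u g) := rfl

@[simp] theorem rz_tlam_app : (rz (.tlam l A t) g).app n = rz t (.cons n g) :=
  Alg.eval_lam_app _ _ _

@[simp] theorem rz_tapp : rz (.tapp l A t F) g = (rz t g).app .idA := rfl

@[simp] theorem rz_down : rz (.down H A c) g = rz c g := rfl

@[simp] theorem rz_up : rz (.up H A c) g = rz c g := rfl

@[simp] theorem rz_hdl : rz (.hdl H A h c) g =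
    (((rz c g).app (rz h g)).app .idA).app ((rz h g).fst.app .idA) := rfl

@[simp] theorem rz_val_app :
    (((rz (.val H A a) g).app n).app d).app m = m.app (rz a g) :=
  Alg.valT_app g (rz a g) n d m

theorem rz_letin_app : ∃ x : Alg,
    (((rz (.letin H A B c k) g).app n).app d).app m = (((rz c g).app n).app d).app x ∧
      ∀ a, x.app a = (((rz k (.cons a g)).app n).app d).app m := by
  obtain ⟨x, h, hx⟩ := Alg.letT_app g (rz c g) (Alg.eval (.lam (erase k)) g) n d m
  refine ⟨x, h, fun a => ?_⟩
  rw [hx, Alg.eval_lam_app]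
  rfl

theorem rz_hfun_app : (((((rz (.hfun o f t) g).app n).app d).app m).app x).app y =
    rz t (.cons y (.cons x (.cons m (.cons d (.cons n g))))) := by
  simp [rz, erase]

@[simp] theorem rz_hdlr_fst : (rz (.hdlr M r b a) g).fst = rz r g := by simp [rz, erase]

@[simp] theorem rz_hdlr_snd_fst : (rz (.hdlr M r b a) g).snd.fst = rz b g := by simp [rz, erase]

@[simp] theorem rz_hdlr_snd_snd : (rz (.hdlr M r b a) g).snd.snd = rz a g := by simp [rz, erase]

@[simp] theorem rz_retApp :
    rz (.retApp M r A a) g = ((rz r g).app .idA).app (rz a g) := rfl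

@[simp] theorem rz_bindApp : rz (.bindApp M b A B t k) g =
    ((((rz b g).app .idA).app .idA).app (rz t g)).app (rz k g) := rfl

theorem rz_fctOfMnd_app : ∃ k : Alg, ((((rz (.fctOfMnd M r b) g).app n).app d).app x).app m =
    ((((rz b g).app .idA).app .idA).app m).app k ∧
      ∀ a, k.app a = ((rz r g).app .idA).app (x.app a) := by
  simp only [Ex.fctOfMnd, rz_tlam_app, rz_lam_app, rz_bindApp, rz_wk_four, rz_var, Alg.cons_zero]
  exact ⟨_, rfl, fun a => by simp⟩

theorem rz_thRet_app :
    (((((rz (.thRet H) g).app n).app x).app d).app m).app y = y.app x := by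
  simp [Ex.thRet]

theorem rz_thBind_app : ∃ l : Alg,
    (((((((rz (.thBind H) g).app n).app d).app x).app y).app m).app d').app z =
      ((x.app m).app d').app l ∧ ∀ a, l.app a = (((y.app a).app m).app d').app z := by
  simp only [Ex.thBind, rz_tlam_app, rz_lam_app, rz_down]
  obtain ⟨l, h, hl⟩ := rz_letin_app (H.wk 4) (.var 3) (.var 2) (.up (H.wk 4) (.var 3) (.var 1))
    (.up (H.wk 5) (.var 3) (.app (.var 4) (Ex.tyapp ((Ex.thObj H).wk 5) (.var 3)) (.var 1) (.var 0)))
    (.cons y (.cons x (.cons d (.cons n g)))) m d' z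
  refine ⟨l, by rw [h]; simp, fun a => ?_⟩
  rw [hl]
  simp

theorem rz_hdlTrans_app : ((rz (.hdlTrans H M h) g).app n).app x =
    ((x.app (rz h g)).app .idA).app ((rz h g).fst.app .idA) := by
  simp [Ex.hdlTrans]

end

/-! ### Realizers of operations and thunks -/

section

variable {H : (PER → PER) → PER → PER}
  {hmap : (PER → PER) → Set Alg → (PER → PER) → Set Alg → Set Alg → Set Alg}
  {A B : PER} {P : Set Alg} {K : Set Alg → Set Alg} {nH np nk : Alg}

/-- The functors that `opT` builds by `fctT`, from the unit and bind of thunks and from those of the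
handler, realize the functors in `opC`; hence `hmap` may be applied to them. -/
theorem op_app_real (hH : HfReal H hmap nH) (hp : (H (coP H) A).Real np P)
    (hk : ∀ n N, A.Real n N → (coP H B).Real (nk.app n) (K N))
    {h : Hdlr} {n m : Alg} {C : PER} {r : Set Alg} (hh : h.Real H n)
    (hm : (PER.arr B (h.M C)).Real m r) (g : ℕ → Alg) (d : Alg) :
    (h.M C).Real
      ((((((Alg.eval Tm.opT g).app nH).app np).app nk).app n).app d |>.app m)
      (opAt H A h C (opTransC H hmap h) P (lamC A.asm fun a => coApp B (K a.1) h C r)) := by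
  obtain ⟨τ, l, g', e, hτ, hl⟩ := Alg.opT_app g nH np nk n d m
  rw [e]
  refine opAt_real hh (hH _ _ (fct_real (thRet_real fun e x n d m => ?_)
    (thBind_real fun e e' c k n d m => ?_) fun e e' x m => Alg.fctT_app g' _ _ e e' x m)
    (fct_real hh.1 hh.2.1 fun e e' x m => Alg.fctT_app g' _ _ e e' x m) (hdlTrans_real hh hτ)) hp
    (cont_real (k := nk.app) hk hh hm d hl) _ _ _ _
  · simp
  · simpa using Alg.letT_app _ c k n d m

variable {e p k E E' : Ex} {g : ℕ → Alg}

theorem rz_op_app_real (hH : HfReal H hmap (rz e g)) (hp : (H (coP H) A).Real (rz p g) P)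
    (hk : ∀ n N, A.Real n N → (coP H B).Real (rz k (.cons n g)) (K N))
    {h : Hdlr} {n m : Alg} {C : PER} {r : Set Alg} (hh : h.Real H n)
    (hm : (PER.arr B (h.M C)).Real m r) (d : Alg) :
    (h.M C).Real ((((rz (.op e E E' p k) g).app n).app d).app m)
      (opAt H A h C (opTransC H hmap h) P (lamC A.asm fun a => coApp B (K a.1) h C r)) :=
  op_app_real (nk := Alg.eval (.lam (erase k)) g) hH hp
    (fun n N h => by rw [Alg.eval_lam_app]; exact hk n N h) hh hm g d

theorem rz_op_real (hH : HfReal H hmap (rz e g)) (hp : (H (coP H) A).Real (rz p g) P)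
    (hk : ∀ n N, A.Real n N → (coP H B).Real (rz k (.cons n g)) (K N)) :
    (coP H B).Real (rz (.op e E E' p k) g) (opC H hmap A B P K) := by
  rw [opC_eq]
  exact co_lam fun h n C d r m hh hm => rz_op_app_real hH hp hk hh hm d

theorem rz_letin_real {c : Ex} {C : Set Alg} (hc : (coP H A).Real (rz c g) C)
    (hk : ∀ n N, A.Real n N → (coP H B).Real (rz k (.cons n g)) (K N)) :
    (coP H B).Real (rz (.letin e E E' c k) g) (letC H A B C K) :=
  let_real hc hk (rz_letin_app _ _ _ _ _ _)

end

/-- The syntactic functor of thunks realizes the element that `opT` realizes by its own combinators.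
Hence both may be fed to `hmap` with the same semantic outcome. -/
theorem thunk_fct_real {H : (PER → PER) → PER → PER} (e : Ex) (g : ℕ → Alg) :
    (fmapP (coP H)).Real (rz (.fctOfMnd (.thObj e) (.thRet e) (.thBind e)) g)
      (fctC (coP H) (thRetC H) (thBindC H)) :=
  fct_real (thRet_real fun _ _ _ _ _ => rz_thRet_app _ _ _ _ _ _ _)
    (thBind_real fun _ _ _ _ _ _ _ => rz_thBind_app _ _ _ _ _ _ _ _ _)
    fun _ _ _ _ => rz_fctOfMnd_app _ _ _ _ _ _ _ _

/-! ### Semantic judgements -/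

/-- `v` and `v'` are the same element of the type `R`, realized by `a` and by `a'`. -/
def Elem (R : PER) (v v' : Val) (a a' : Alg) : Prop :=
  ∃ C, v = .cl C ∧ v' = .cl C ∧ R.Real a C ∧ R.Real a' C

namespace Elem

variable {R : PER} {v v' w : Val} {a a' b : Alg} {C C' : Set Alg}

/-- Here the left realizer `a` is the common one and forces `C = C'`; in `mk_right` it is `a'`.
Congruence rules and handling laws use the first, most of the remaining laws the second. -/
theorem mk_left (h : R.Real a C) (h' : R.Real a C') (h'' : R.Real a' C') :
    Elem R (.cl C) (.cl C') a a' :=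
  ⟨C, rfl, by rw [h.unique h'], h, by rwa [h.unique h']⟩

theorem mk_right (h : R.Real a C) (h' : R.Real a' C) (h'' : R.Real a' C') :
    Elem R (.cl C) (.cl C') a a' :=
  ⟨C, rfl, by rw [h'.unique h''], h, h'⟩

theorem real (h : Elem R v v' a a') : R.Real a v.toCl := by
  obtain ⟨C, rfl, rfl, h, h'⟩ := h; exact h

theorem real_right (h : Elem R v v' a a') : R.Real a v'.toCl := by
  obtain ⟨C, rfl, rfl, h, h'⟩ := h; exact h

theorem real' (h : Elem R v v' a a') : R.Real a' v'.toCl := by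
  obtain ⟨C, rfl, rfl, h, h'⟩ := h; exact h'

theorem eq_cl (h : Elem R v v' a a') : v = .cl v.toCl := by
  obtain ⟨C, rfl, rfl, h, h'⟩ := h; rfl

theorem symm (h : Elem R v v' a a') : Elem R v' v a' a := by
  obtain ⟨C, h, h', h1, h2⟩ := h; exact ⟨C, h', h, h2, h1⟩

theorem trans (h : Elem R v v' a a') (h' : Elem R v' w a' b) : Elem R v w a b := by
  obtain ⟨C, rfl, rfl, h, -⟩ := h
  obtain ⟨C, h', rfl, -, h''⟩ := h'
  cases h'
  exact ⟨_, rfl, rfl, h, h''⟩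

end Elem

/-- `v` and `v'` are the same element of the judgement form `J`, realized by `a` and by `a'`. -/
def Holds (J : Judg) (ρ : Env) (v v' : Val) (a a' : Alg) : Prop :=
  match J with
  | .el k => ∃ x, v = .el k x ∧ v' = .el k x
  | .tm A => Elem (sem A ρ).toTy v v' a a'
  | .co H A => Elem (coP (sem H ρ).obj (sem A ρ).toTy) v v' a a'
  | .hfun => ∃ o f f' m m', v = .hf o f m ∧ v' = .hf o f' m' ∧
      HfReal o m a ∧ HfReal o m' a ∧ HfReal o m a' ∧ HfReal o m' a'
  | .hdlr H => ∃ h, v = .hd h ∧ v' = .hd h ∧ h.Real (sem H ρ).obj a ∧ h.Real (sem H ρ).obj a'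

theorem Holds.symm {J : Judg} {ρ : Env} {v v' : Val} {a a' : Alg} (h : Holds J ρ v v' a a') :
    Holds J ρ v' v a' a := by
  cases J with
  | el k => obtain ⟨x, h, h'⟩ := h; exact ⟨x, h', h⟩
  | tm A => exact Elem.symm h
  | co H A => exact Elem.symm h
  | hfun =>
    obtain ⟨o, f, f', m, m', h, h', h1, h2, h3, h4⟩ := h
    exact ⟨o, f', f, m', m, h', h, h4, h3, h2, h1⟩
  | hdlr H => obtain ⟨x, h, h', h1, h2⟩ := h; exact ⟨x, h', h, h2, h1⟩

/-- Equal higher-order functors share their object part, while their `hmap` functions need agree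
only on realized arguments. On those, the common realizer `a'` forces agreement. -/
theorem HfReal.trans {o : (PER → PER) → PER → PER}
    {m m' : (PER → PER) → Set Alg → (PER → PER) → Set Alg → Set Alg → Set Alg} {a a' : Alg}
    (h : HfReal o m a) (h₁ : HfReal o m a') (h₂ : HfReal o m' a') : HfReal o m' a := by
  intro F φ nφ G γ nγ τ nτ d d' hφ hγ hτ
  rw [← (h₁ d d' hφ hγ hτ).unique (h₂ d d' hφ hγ hτ)]
  exact h d d' hφ hγ hτ

theorem Holds.trans {J : Judg} {ρ : Env} {v v' v'' : Val} {a a' a'' : Alg}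
    (h : Holds J ρ v v' a a') (h' : Holds J ρ v' v'' a' a'') : Holds J ρ v v'' a a'' := by
  cases J with
  | el k =>
    obtain ⟨x, rfl, rfl⟩ := h
    obtain ⟨y, h, rfl⟩ := h'
    cases h
    exact ⟨_, rfl, rfl⟩
  | tm A => exact Elem.trans h h'
  | co H A => exact Elem.trans h h'
  | hfun =>
    obtain ⟨o, f, f', m, m', rfl, rfl, h1, h2, h3, h4⟩ := h
    obtain ⟨o', f', f'', m', m'', h, rfl, h1', h2', h3', h4'⟩ := h'
    cases h
    exact ⟨_, _, _, _, _, rfl, rfl, h1, h2.trans h1' h2', h3'.trans h4 h3, h4'⟩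
  | hdlr H =>
    obtain ⟨x, rfl, rfl, h, -⟩ := h
    obtain ⟨y, h', rfl, -, h''⟩ := h'
    cases h'
    exact ⟨_, rfl, rfl, h, h''⟩

theorem Holds.wk {J : Judg} {ρ : Env} {v v' w : Val} {a a' : Alg} (h : Holds J ρ v v' a a') :
    Holds J.wk (ρ.cons w) v v' a a' := by
  cases J <;> simpa [Holds, Judg.wk] using h

/-- `ρ` is an element of the context `Γ`, realized by `g`. -/
def Sat (Γ : Ctx) (ρ : Env) (g : ℕ → Alg) : Prop :=
  ∀ i J, Lookup Γ i J → Holds J ρ (ρ i) (ρ i) (g i) (g i)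

namespace Sat

variable {Γ : Ctx} {ρ : Env} {g : ℕ → Alg}

theorem nil (ρ : Env) (g : ℕ → Alg) : Sat [] ρ g := by
  intro i J h; cases h

theorem cons (hs : Sat Γ ρ g) {J : Judg} {v : Val} {a : Alg} (h : Holds J ρ v v a a) :
    Sat (J :: Γ) (ρ.cons v) (.cons a g) := by
  intro i J' hl
  cases hl with
  | zero => exact h.wk
  | succ _ hl => exact (hs _ _ hl).wk

theorem el (hs : Sat Γ ρ g) {k : Kd} (x : KSem k) (n : Alg) :
    Sat (.el k :: Γ) (ρ.cons (.el k x)) (.cons n g) :=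
  hs.cons ⟨x, rfl, rfl⟩

theorem tm (hs : Sat Γ ρ g) {A : Ex} {n : Alg} {C : Set Alg} (h : (sem A ρ).toTy.Real n C) :
    Sat (.tm A :: Γ) (ρ.cons (.cl C)) (.cons n g) :=
  hs.cons ⟨C, rfl, rfl, h, h⟩

end Sat

end Rz

namespace Rz

open LC FHa

/-! ### Soundness of the computation laws -/

section

variable {H : (PER → PER) → PER → PER} {A B D : PER} {C : Set Alg} {K K' : Set Alg → Set Alg}
  {e E E₁ E₂ c k k' : Ex} {g : ℕ → Alg}

/-- Given a handler, a type and a continuation, the erasures of both sides evaluate to the same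
element of the algebra. -/
theorem val_let_elem {a : Ex} {N : Set Alg} (ha : A.Real (rz a g) N)
    (hk : ∀ n N, A.Real n N → (coP H B).Real (rz k (.cons n g)) (K N)) :
    Elem (coP H B) (.cl (letC H A B (valC H A N) K)) (.cl (K N))
      (rz (.letin e E E₁ (.val e E a) k) g) (rz (k.inst a) g) := by
  have h := rz_letin_real (e := e) (E := E) (E' := E₁)
    (val_real (H := H) ha fun n d m => rz_val_app e E a g n d m) hk
  have h' := hk _ _ ha
  rw [rz_inst]
  refine Elem.mk_right h (co_ext h fun x n D d r m hx hm => ⟨_, ?_, co_app h' hx hm d⟩) h'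
  obtain ⟨l, el, hl⟩ := rz_letin_app e E E₁ (.val e E a) k g n d m
  rw [el, rz_val_app, hl]
  exact co_app h' hx hm d

theorem let_val_elem (hc : (coP H A).Real (rz c g) C) :
    Elem (coP H A) (.cl (letC H A A C fun a => valC H A a)) (.cl C)
      (rz (.letin e E E c (.val (e.wk 1) (E.wk 1) (.var 0))) g) (rz c g) := by
  have h := rz_letin_real (e := e) (E := E) (E' := E) (k := .val (e.wk 1) (E.wk 1) (.var 0)) hc
    fun n N hn => val_real (H := H) hn fun n' d m => by rw [rz_val_app, rz_var]; rfl
  refine Elem.mk_right h (co_ext h fun x n D d r m hx hm => ⟨_, ?_, co_app hc hx hm d⟩) hc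
  obtain ⟨l, el, hl⟩ := rz_letin_app e E E c (.val (e.wk 1) (E.wk 1) (.var 0)) g n d m
  rw [el]
  -- The continuation `l` is only an η-expansion of `m`, so extensionality of the function type
  -- replaces β-equality.
  refine co_app hc hx (PER.arr_ext hm fun y a ha => ?_) d
  rw [hl, rz_val_app, rz_var]
  exact PER.arr_app hm ha

/-- Both sides run `c`, then `k`, then `k'`, but with continuations that agree only in their values;
each is shown to realize the same nested semantic continuation. -/
theorem let_assoc_elem (hc : (coP H A).Real (rz c g) C)
    (hk : ∀ n N, A.Real n N → (coP H B).Real (rz k (.cons n g)) (K N))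
    (hk' : ∀ n N, B.Real n N → (coP H D).Real (rz k' (.cons n g)) (K' N)) :
    Elem (coP H D) (.cl (letC H B D (letC H A B C K) K'))
      (.cl (letC H A D C fun a => letC H B D (K a) K'))
      (rz (.letin e E₁ E₂ (.letin e E E₁ c k) k') g)
      (rz (.letin e E E₂ c (.letin (e.wk 1) (E₁.wk 1) (E₂.wk 1) k (k'.rename (FHa.liftR (· + 1))))) g) := by
  have hk'' : ∀ x n N, B.Real n N →
      (coP H D).Real (rz (k'.rename (FHa.liftR (· + 1))) (.cons n (.cons x g))) (K' N) := by
    intro x n N hn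
    rw [rz_rename_liftR]
    exact hk' n N hn
  have h := rz_letin_real (e := e) (E := E₁) (E' := E₂)
    (rz_letin_real (e := e) (E := E) (E' := E₁) hc hk) hk'
  refine Elem.mk_right h (co_ext h fun x n F d r m hx hm => ?_)
    (rz_letin_real hc fun n N hn => rz_letin_real (hk n N hn) (hk'' n))
  obtain ⟨l₁, e₁, hl₁⟩ := rz_letin_app e E₁ E₂ (.letin e E E₁ c k) k' g n d m
  obtain ⟨l₂, e₂, hl₂⟩ := rz_letin_app e E E₁ c k g n d l₁
  obtain ⟨l₃, e₃, hl₃⟩ := rz_letin_app e E E₂ c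
    (.letin (e.wk 1) (E₁.wk 1) (E₂.wk 1) k (k'.rename (FHa.liftR (· + 1)))) g n d m
  rw [e₁, e₂, e₃]
  refine ⟨_, co_app hc hx (cont_real hk hx (cont_real hk' hx hm d hl₁) d hl₂) d,
    co_app hc hx (PER.arr_lam fun a na ha => ?_) d⟩
  obtain ⟨l₄, e₄, hl₄⟩ := rz_letin_app (e.wk 1) (E₁.wk 1) (E₂.wk 1) k
    (k'.rename (FHa.liftR (· + 1))) (.cons na g) n d m
  rw [hl₃, e₄]
  exact co_app (hk na a.1 ha) hx (cont_real (hk'' na) hx hm d hl₄) d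

variable {hmap : (PER → PER) → Set Alg → (PER → PER) → Set Alg → Set Alg → Set Alg}
  {p : Ex} {P : Set Alg}

/-- Both sides perform the same operation at the given handler; only the continuations handed to its
bind have to be compared. -/
theorem let_op_elem (hH : HfReal H hmap (rz e g)) (hp : (H (coP H) A).Real (rz p g) P)
    (hk : ∀ n N, A.Real n N → (coP H B).Real (rz k (.cons n g)) (K N))
    (hk' : ∀ n N, B.Real n N → (coP H D).Real (rz k' (.cons n g)) (K' N)) :
    Elem (coP H D) (.cl (letC H B D (opC H hmap A B P K) K'))
      (.cl (opC H hmap A D P fun a => letC H B D (K a) K'))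
      (rz (.letin e E₁ E₂ (.op e E E₁ p k) k') g)
      (rz (.op e E E₂ p (.letin (e.wk 1) (E₁.wk 1) (E₂.wk 1) k (k'.rename (FHa.liftR (· + 1))))) g) := by
  have hk'' : ∀ x n N, B.Real n N →
      (coP H D).Real (rz (k'.rename (FHa.liftR (· + 1))) (.cons n (.cons x g))) (K' N) := by
    intro x n N hn
    rw [rz_rename_liftR]
    exact hk' n N hn
  have hkk : ∀ n N, A.Real n N → (coP H D).Real
      (rz (.letin (e.wk 1) (E₁.wk 1) (E₂.wk 1) k (k'.rename (FHa.liftR (· + 1)))) (.cons n g))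
      (letC H B D (K N) K') := fun n N hn => rz_letin_real (hk n N hn) (hk'' n)
  have h := rz_letin_real (e := e) (E := E₁) (E' := E₂)
    (rz_op_real (E := E) (E' := E₁) hH hp hk) hk'
  refine Elem.mk_right h (co_ext h fun x n F d r m hx hm => ?_) (rz_op_real hH hp hkk)
  obtain ⟨l₁, e₁, hl₁⟩ := rz_letin_app e E₁ E₂ (.op e E E₁ p k) k' g n d m
  rw [e₁]
  refine ⟨_, rz_op_app_real hH hp hk hx (cont_real hk' hx hm d hl₁) d, ?_⟩
  convert rz_op_app_real hH hp hkk hx hm d using 3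
  -- The two semantic continuations must agree at each `a`. A realizer `na` of `a` yields one
  -- element of the algebra realizing both values, so they are equal by uniqueness.
  funext a
  obtain ⟨na, hna⟩ := A.asm.exists_real a
  have ha : A.Real na a.1 := a.2.real hna
  obtain ⟨l₄, e₄, hl₄⟩ := rz_letin_app (e.wk 1) (E₁.wk 1) (E₂.wk 1) k
    (k'.rename (FHa.liftR (· + 1))) (.cons na g) n d m
  have h₁ := co_app (hkk na a.1 ha) hx hm d
  rw [e₄] at h₁
  exact (co_app (hk na a.1 ha) hx (cont_real (hk'' na) hx hm d hl₄) d).unique h₁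

/-- Both sides evaluate to the unit of the handler applied to a dummy type and the realizer of `a`.
The equation `hF` matches the monad stored in `h` with the one that occurs in the type. -/
theorem hdl_val_elem {a : Ex} {N : Set Alg} {h : Hdlr} {M r b m : Ex} {F : PER → PER}
    (ha : A.Real (rz a g) N) (hh : h.Real H (rz (.hdlr M r b m) g)) (hF : h.M = F) :
    Elem (F A) (.cl (hdlC A h (valC H A N)))
      (.cl (appC (F A) (appP (.arr A (F A)) h.ret) N))
      (rz (.hdl e E (.hdlr M r b m) (.val e E a)) g) (rz (.retApp M r E a) g) := by
  subst hF
  have h₁ := hdl_real (val_real (H := H) ha fun n d m => rz_val_app e E a g n d m) hh .idA .idA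
  have h₂ := ret_real hh.1 ha .idA
  rw [rz_val_app, rz_hdlr_fst] at h₁
  rw [rz_hdlr_fst] at h₂
  rw [rz_hdl, rz_val_app, rz_hdlr_fst]
  exact Elem.mk_left h₁ h₂ h₂

end

theorem sem_app (A B t u : Ex) (ρ : Env) : sem (.app A B t u) ρ =
    .cl (appC (sem B ρ).toTy (sem t ρ).toCl (sem u ρ).toCl) := rfl

theorem sem_hdl (H A h c : Ex) (ρ : Env) : sem (.hdl H A h c) ρ =
    .cl (hdlC (sem A ρ).toTy (sem h ρ).toHd (sem c ρ).toCl) := rfl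

/-- The handler law for operations, for a handler with underlying monad `F`. -/
theorem hdl_op_elem {ρ : Env} {g : ℕ → Alg} {o f hm A B M r b m p k : Ex} {F : PER → PER}
    (hM : sem M ρ = ofEfty F)
    (hH : HfReal (sem (.hfun o f hm) ρ).obj (sem (.hfun o f hm) ρ).hmap (rz (.hfun o f hm) g))
    (hh : (sem (.hdlr M r b m) ρ).toHd.Real (sem (.hfun o f hm) ρ).obj (rz (.hdlr M r b m) g))
    (hp : ((sem (.hfun o f hm) ρ).obj (coP (sem (.hfun o f hm) ρ).obj) (sem A ρ).toTy).Real
      (rz p g) (sem p ρ).toCl)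
    (hk : ∀ n N, (sem A ρ).toTy.Real n N →
      (coP (sem (.hfun o f hm) ρ).obj (sem B ρ).toTy).Real (rz k (.cons n g))
        (sem k (ρ.cons (.cl N))).toCl) :
    Elem (F (sem B ρ).toTy)
      (sem (.hdl (.hfun o f hm) B (.hdlr M r b m) (.op (.hfun o f hm) A B p k)) ρ)
      (sem (.bindApp M b A B (.app (Ex.tyapp (.happ o M) A) (.tyapp M A)
          (.transAt (.happ o M) M m A) (.hdlArg o f hm M r b m A p))
        (.lam A (.tyapp M B) (.hdl ((Ex.hfun o f hm).wk 1) (B.wk 1) ((Ex.hdlr M r b m).wk 1) k))) ρ)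
      (rz (.hdl (.hfun o f hm) B (.hdlr M r b m) (.op (.hfun o f hm) A B p k)) g)
      (rz (.bindApp M b A B (.app (Ex.tyapp (.happ o M) A) (.tyapp M A)
          (.transAt (.happ o M) M m A) (.hdlArg o f hm M r b m A p))
        (.lam A (.tyapp M B) (.hdl ((Ex.hfun o f hm).wk 1) (B.wk 1) ((Ex.hdlr M r b m).wk 1) k)))
        g) := by
  have hF : (sem (.hdlr M r b m) ρ).toHd.M = F := by
    simp only [sem, hM, toEl_ofEfty]
    rfl
  -- The right-hand side of the law denotes the operation `opAt` at this handler, with the unit of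
  -- its monad as final continuation.
  have hrhs : sem (.bindApp M b A B (.app (Ex.tyapp (.happ o M) A) (.tyapp M A)
          (.transAt (.happ o M) M m A) (.hdlArg o f hm M r b m A p))
        (.lam A (.tyapp M B) (.hdl ((Ex.hfun o f hm).wk 1) (B.wk 1) ((Ex.hdlr M r b m).wk 1) k))) ρ =
      .cl (opAt (sem (.hfun o f hm) ρ).obj (sem A ρ).toTy (sem (.hdlr M r b m) ρ).toHd (sem B ρ).toTy
        (opTransC (sem (.hfun o f hm) ρ).obj (sem (.hfun o f hm) ρ).hmap
          (sem (.hdlr M r b m) ρ).toHd) (sem p ρ).toCl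
        (lamC (sem A ρ).toTy.asm fun a => coApp (sem B ρ).toTy (sem k (ρ.cons (.cl a.1))).toCl
          (sem (.hdlr M r b m) ρ).toHd (sem B ρ).toTy
          ((sem (.hdlr M r b m) ρ).toHd.retAt (sem B ρ).toTy))) := by
    rw [sem_bindApp hM, sem_lam]
    simp only [Ex.hdlArg, sem_transAt (sem_happ hM o) hM, toTy_tyapp hM, sem_app,
      toTy_tyapp (sem_happ hM o), sem_transAt (sem_happ (sem_thObj _ _) o) (sem_happ hM o),
      sem_hmapAt, sem_thObj, sem_fctOfMnd hM, sem_fctOfMnd (sem_thObj _ _), sem_thRet, sem_thBind,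
      sem_hdlTrans, Val.toCl_cl, opAt, opTransC, hF, sem_hdl, sem_wk_one, hM]
    rfl
  rw [hrhs]
  subst hF
  have hγ := fct_real (f := rz (.fctOfMnd M r b) g) hh.1 hh.2.1 fun e e' x m => by
    rw [rz_hdlr_fst, rz_hdlr_snd_fst]
    exact rz_fctOfMnd_app M b r g e e' m x
  -- The realizer of `hmap` is applied to the erasures of the syntactic functors and of the
  -- syntactic handling transformation, as they occur in `hdlArg`.
  have ht := hH (rz (.thObj (.hfun o f hm)) g) (rz M g) (thunk_fct_real (.hfun o f hm) g) hγ
    (hdlTrans_real hh fun e c => rz_hdlTrans_app (.hfun o f hm) M (.hdlr M r b m) g e c)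
  rw [rz_hfun_app, ← rz_hmapAt] at ht
  have hrz := opAt_real hh ht hp (PER.arr_lam (S := (sem (.hdlr M r b m) ρ).toHd.M (sem B ρ).toTy)
    (f := rz (.lam A (.tyapp M B)
      (.hdl ((Ex.hfun o f hm).wk 1) (B.wk 1) ((Ex.hdlr M r b m).wk 1) k)) g)
    fun x n hn => by
      rw [rz_lam_app, rz_hdl, rz_wk_one]
      exact hdl_real (hk n x.1 hn) hh .idA .idA) .idA .idA .idA .idA
  rw [rz_hdlr_snd_fst, rz_hdlr_snd_snd] at hrz
  -- The erasure of the left side realizes both the handled `opC` and its unfolding `opAt`, which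
  -- identifies them; `hrz` says that the erasure of the right side realizes `opAt` too.
  exact Elem.mk_left (hdl_real (rz_op_real (E := A) (E' := B) hH hp hk) hh .idA .idA)
    (rz_op_app_real (E := A) (E' := B) hH hp hk hh (PER.all_app hh.1 (sem B ρ).toTy .idA) .idA) hrz

end Rz

namespace Rz

open LC FHa

/-! ### Soundness -/

/-- The kinds of denotations of well-formed elements of kinds and of monads of handlers. -/
def Shape (J : Judg) (e : Ex) (ρ : Env) : Prop :=
  match J with
  | .el k => ∃ x, sem e ρ = .el k x
  | .hdlr _ => ∀ M r b m, e = .hdlr M r b m → ∃ F, sem M ρ = ofEfty F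
  | _ => True

/-- The denotation of a handler stores only the coerced value of `M`. The handling laws rebuild
types from the expression `M`, and so need to know that it denotes an element of kind `efty` without
coercion. -/
theorem shape_of_eqv {Γ : Ctx} {e e' : Ex} {J : Judg} (h : Eqv Γ e e' J) :
    ∀ ρ g, Sat Γ ρ g → Shape J e ρ ∧ Shape J e' ρ := by
  induction h with
  | @var Γ i J h =>
    intro ρ g hs
    have := hs _ _ h
    cases J with
    | el k => obtain ⟨x, hx, -⟩ := this; exact ⟨⟨x, hx⟩, ⟨x, hx⟩⟩
    -- A variable is not a handler expression, so the condition is vacuous.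
    | hdlr H => exact ⟨fun _ _ _ _ h => (nomatch h), fun _ _ _ _ h => (nomatch h)⟩
    | _ => exact ⟨trivial, trivial⟩
  | symm _ ih => intro ρ g hs; exact (ih ρ g hs).symm
  | trans _ _ ih ih' => intro ρ g hs; exact ⟨(ih ρ g hs).1, (ih' ρ g hs).2⟩
  | convHdlr _ _ _ ih => exact ih
  | kbeta _ _ ih ih' =>
    intro ρ g hs
    refine ⟨⟨_, rfl⟩, ?_⟩
    obtain ⟨x, hx⟩ := (ih' ρ g hs).1
    obtain ⟨y, hy⟩ := (ih _ _ (hs.el x .idA)).1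
    exact ⟨y, by rw [sem_inst, hx, hy]⟩
  | keta _ ih => intro ρ g hs; exact ⟨⟨_, rfl⟩, (ih ρ g hs).1⟩
  | hdlr _ _ _ _ _ _ ih =>
    intro ρ g hs
    constructor
    · rintro _ _ _ _ ⟨⟩
      exact (ih ρ g hs).1
    · rintro _ _ _ _ ⟨⟩
      exact (ih ρ g hs).2
  | klam | kapp | unit | bool | fn | all | th =>
    intros; exact ⟨⟨_, rfl⟩, ⟨_, rfl⟩⟩
  | _ => intros; exact ⟨trivial, trivial⟩

theorem lamA_real {R S : PER} {f : Alg} {t : Set Alg → Set Alg}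
    (h : ∀ n N, R.Real n N → S.Real (f.app n) (t N)) : (PER.arr R S).Real f (lamA R t) :=
  PER.arr_lam fun x n hn => h n x.1 hn

theorem toTy_fn (A B : Ex) (ρ : Env) :
    (sem (.fn A B) ρ).toTy = .arr (sem A ρ).toTy (sem B ρ).toTy := toTy_ofTy _

/-- Quantification over the elements of a kind. -/
def allK (k : Kd) (S : KSem k → PER) : PER := .pi (.codisc (KSem k)) S

/-- The element of `allK k S` given by a family. -/
def lamK (k : Kd) (s : KSem k → Set Alg) : Set Alg := lamC (.codisc (KSem k)) s

section

variable {k : Kd} {S : KSem k → PER} {s : KSem k → Set Alg} {f : Alg} {F : Set Alg}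

theorem allK_lam (h : ∀ x n, (S x).Real (f.app n) (s x)) : (allK k S).Real f (lamK k s) :=
  PER.all_lam h

theorem allK_app (hf : (allK k S).Real f F) (x : KSem k) (n : Alg) :
    (S x).Real (f.app n) (appP (S x) F) := PER.all_app hf x n

theorem allK_eta (hf : (allK k S).Real f F) : lamK k (fun x => appP (S x) F) = F :=
  PER.all_eta hf

end

theorem sem_var (i : ℕ) (ρ : Env) : sem (.var i) ρ = ρ i := rfl

theorem sem_all (k : Kd) (A : Ex) (ρ : Env) :
    sem (.all k A) ρ = ofTy (allK k fun x => (sem A (ρ.cons (.el k x))).toTy) := rfl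

theorem sem_tlam (k : Kd) (A t : Ex) (ρ : Env) :
    sem (.tlam k A t) ρ = .cl (lamK k fun x => (sem t (ρ.cons (.el k x))).toCl) := rfl

theorem sem_tapp (k : Kd) (A t F : Ex) (ρ : Env) : sem (.tapp k A t F) ρ =
    .cl (appP (sem A (ρ.cons (.el k ((sem F ρ).toEl k)))).toTy (sem t ρ).toCl) := rfl

theorem toTy_all (k : Kd) (A : Ex) (ρ : Env) : (sem (.all k A) ρ).toTy =
    allK k fun x => (sem A (ρ.cons (.el k x))).toTy := toTy_ofTy _

theorem Val.toEl_klam (k l : Kd) (f : KSem k → KSem l) :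
    (Val.el (.arr k l) f).toEl (.arr k l) = f := Val.toEl_el (.arr k l) f

theorem toTy_th (H A : Ex) (ρ : Env) :
    (sem (.th H A) ρ).toTy = coP (sem H ρ).obj (sem A ρ).toTy := toTy_ofTy _

theorem Holds.el_eq {k : Kd} {ρ : Env} {v v' : Val} {a a' : Alg}
    (h : Holds (.el k) ρ v v' a a') : v' = v := by
  obtain ⟨x, rfl, rfl⟩ := h; rfl

theorem Holds.obj_eq {ρ : Env} {v v' : Val} {a a' : Alg}
    (h : Holds .hfun ρ v v' a a') : v'.obj = v.obj := by
  obtain ⟨o, f, f', m, m', rfl, rfl, h⟩ := h; rfl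

theorem Holds.hf_real {ρ : Env} {v v' : Val} {a a' : Alg}
    (h : Holds .hfun ρ v v' a a') : HfReal v.obj v.hmap a ∧ HfReal v.obj v'.hmap a ∧
      HfReal v.obj v'.hmap a' := by
  obtain ⟨o, f, f', m, m', rfl, rfl, h1, h2, -, h4⟩ := h; exact ⟨h1, h2, h4⟩

theorem Holds.hd_real {ρ : Env} {v v' : Val} {a a' : Alg} {H : Ex}
    (h : Holds (.hdlr H) ρ v v' a a') : v' = v ∧ v.toHd.Real (sem H ρ).obj a ∧
      v.toHd.Real (sem H ρ).obj a' := by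
  obtain ⟨x, rfl, rfl, h, h'⟩ := h; exact ⟨rfl, h, h'⟩

theorem toTy_tyapp_toEl (f a : Ex) (ρ : Env) :
    (sem (Ex.tyapp f a) ρ).toTy = (sem f ρ).toEl .efty (sem a ρ).toTy := Val.toEl_el .ty _

section

variable {Γ : Ctx} {ρ : Env} {g : ℕ → Alg} {A B H k k' : Ex}

theorem Sat.tm_binder (hs : Sat Γ ρ g)
    (ih : ∀ ρ g, Sat (.tm A :: Γ) ρ g →
      Holds (.tm (B.wk 1)) ρ (sem k ρ) (sem k' ρ) (rz k g) (rz k' g)) (n : Alg) (N : Set Alg)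
    (hn : (sem A ρ).toTy.Real n N) :
    Elem (sem B ρ).toTy (sem k (ρ.cons (.cl N))) (sem k' (ρ.cons (.cl N)))
      (rz k (.cons n g)) (rz k' (.cons n g)) := by
  simpa only [Holds, sem_wk_one] using ih _ _ (hs.tm hn)

theorem Sat.co_binder (hs : Sat Γ ρ g)
    (ih : ∀ ρ g, Sat (.tm A :: Γ) ρ g →
      Holds (.co (H.wk 1) (B.wk 1)) ρ (sem k ρ) (sem k' ρ) (rz k g) (rz k' g))
    (n : Alg) (N : Set Alg) (hn : (sem A ρ).toTy.Real n N) :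
    Elem (coP (sem H ρ).obj (sem B ρ).toTy) (sem k (ρ.cons (.cl N))) (sem k' (ρ.cons (.cl N)))
      (rz k (.cons n g)) (rz k' (.cons n g)) := by
  simpa only [Holds, sem_wk_one] using ih _ _ (hs.tm hn)

end

/-- An environment for `hmap` is assembled from arbitrary realized functors and a realized
transformation. The `hfmap` components are left unconstrained: no denotation of a computation uses
them. -/
theorem hfun_holds {Γ : Ctx} {ρ : Env} {g : ℕ → Alg} {o o' f f' m m' : Ex} (hs : Sat Γ ρ g)
    (iho : Holds (.el .htyco) ρ (sem o ρ) (sem o' ρ) (rz o g) (rz o' g))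
    (ihm : ∀ ρ g, Sat (.tm (.trans (.var 3) (.var 1)) :: .tm (.fmapTy (.var 0)) :: .el .efty ::
          .tm (.fmapTy (.var 0)) :: .el .efty :: Γ) ρ g →
      Holds (.tm (.trans (.happ (o.wk 5) (.var 4)) (.happ (o.wk 5) (.var 2)))) ρ
        (sem m ρ) (sem m' ρ) (rz m g) (rz m' g)) :
    Holds .hfun ρ (sem (.hfun o f m) ρ) (sem (.hfun o' f' m') ρ) (rz (.hfun o f m) g)
      (rz (.hfun o' f' m') g) := by
  have key : ∀ ⦃F φ nφ G γ nγ τ nτ⦄ (d d' : Alg), (fmapP F).Real nφ φ → (fmapP G).Real nγ γ →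
      (transP F G).Real nτ τ →
      Elem (transP ((sem o ρ).toEl .htyco F) ((sem o ρ).toEl .htyco G))
        (sem m (((((ρ.cons (ofEfty F)).cons (.cl φ)).cons (ofEfty G)).cons (.cl γ)).cons (.cl τ)))
        (sem m' (((((ρ.cons (ofEfty F)).cons (.cl φ)).cons (ofEfty G)).cons (.cl γ)).cons (.cl τ)))
        (rz m (.cons nτ (.cons nγ (.cons d' (.cons nφ (.cons d g))))))
        (rz m' (.cons nτ (.cons nγ (.cons d' (.cons nφ (.cons d g)))))) := by
    intro F φ nφ G γ nγ τ nτ d d' hφ hγ hτ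
    have h := ihm _ _ (((((hs.el (k := .efty) F d).tm
      (A := .fmapTy (.var 0)) (by rw [toTy_fmapTy (F := F) rfl]; exact hφ)).el (k := .efty) G d').tm
      (A := .fmapTy (.var 0)) (by rw [toTy_fmapTy (F := G) rfl]; exact hγ)).tm
      (A := .trans (.var 3) (.var 1)) (by rw [toTy_trans (F := F) (G := G) rfl rfl]; exact hτ))
    simp only [Holds] at h
    rw [toTy_trans (sem_happ (F := F) rfl _) (sem_happ (F := G) rfl _), sem_wk_five] at h
    exact h
  -- The four remaining goals pair each of the two `hmap` functions with each of the two erasures.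
  refine ⟨_, _, _, _, _, rfl, by simp only [sem, iho.el_eq]; rfl, ?_, ?_, ?_, ?_⟩ <;>
    intro F φ nφ G γ nγ τ nτ d d' hφ hγ hτ <;> rw [rz_hfun_app]
  · exact (key d d' hφ hγ hτ).real
  · exact (key d d' hφ hγ hτ).real_right
  · exact (key d d' hφ hγ hτ).symm.real_right
  · exact (key d d' hφ hγ hτ).real'

/-- Equal fields are equal as sets of realizers, so both expressions denote literally the same
handler; pairing supplies its realizers. -/
theorem hdlr_holds {ρ : Env} {g : ℕ → Alg} {o f q M M' r r' b b' m m' : Ex}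
    (hM : Holds (.el .efty) ρ (sem M ρ) (sem M' ρ) (rz M g) (rz M' g))
    (hr : Holds (.tm (.retTy M)) ρ (sem r ρ) (sem r' ρ) (rz r g) (rz r' g))
    (hb : Holds (.tm (.bindTy M)) ρ (sem b ρ) (sem b' ρ) (rz b g) (rz b' g))
    (hm : Holds (.tm (.trans (.happ o M) M)) ρ (sem m ρ) (sem m' ρ) (rz m g) (rz m' g)) :
    Holds (.hdlr (.hfun o f q)) ρ (sem (.hdlr M r b m) ρ) (sem (.hdlr M' r' b' m') ρ)
      (rz (.hdlr M r b m) g) (rz (.hdlr M' r' b' m') g) := by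
  obtain ⟨F, hF, hF'⟩ := hM
  simp only [Holds] at hr hb hm
  rw [toTy_retTy hF] at hr
  rw [toTy_bindTy hF] at hb
  rw [toTy_trans (sem_happ hF o) hF] at hm
  have hMF : (sem M ρ).toEl .efty = F := by rw [hF]; exact Val.toEl_el .efty F
  have er : (sem r ρ).toCl = (sem r' ρ).toCl := hr.real.unique hr.real_right
  have eb : (sem b ρ).toCl = (sem b' ρ).toCl := hb.real.unique hb.real_right
  have em : (sem m ρ).toCl = (sem m' ρ).toCl := hm.real.unique hm.real_right
  refine ⟨⟨F, (sem r ρ).toCl, (sem b ρ).toCl, (sem m ρ).toCl⟩, ?_, ?_, ⟨?_, ?_, ?_⟩, ?_, ?_, ?_⟩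
  · simp only [sem, hMF]
  · rw [er, eb, em, ← hMF, hF, ← hF']
    rfl
  · rw [rz_hdlr_fst]; exact hr.real
  · rw [rz_hdlr_snd_fst]; exact hb.real
  · rw [rz_hdlr_snd_snd]; exact hm.real
  · rw [rz_hdlr_fst]; exact hr.symm.real_right
  · rw [rz_hdlr_snd_fst]; exact hb.symm.real_right
  · rw [rz_hdlr_snd_snd]; exact hm.symm.real_right

/-- Soundness of the realizability model: judgementally equal expressions denote the same element,
and their erasures realize it. -/
theorem soundness {Γ : Ctx} {e e' : Ex} {J : Judg} (h : Eqv Γ e e' J) :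
    ∀ ρ g, Sat Γ ρ g → Holds J ρ (sem e ρ) (sem e' ρ) (rz e g) (rz e' g) := by
  induction h with
  | var h => intro ρ g hs; rw [rz_var]; exact hs _ _ h
  | symm _ ih => intro ρ g hs; exact (ih ρ g hs).symm
  | trans _ _ ih ih' => intro ρ g hs; exact (ih ρ g hs).trans (ih' ρ g hs)
  | convTm _ _ ihA ih =>
    intro ρ g hs
    have := ih ρ g hs
    simp only [Holds] at this ⊢
    rwa [(ihA ρ g hs).el_eq]
  | convCo _ _ _ ihH ihA ih =>
    intro ρ g hs
    have := ih ρ g hs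
    simp only [Holds] at this ⊢
    rwa [(ihA ρ g hs).el_eq, (ihH ρ g hs).obj_eq]
  | convHdlr _ _ ihH ih =>
    intro ρ g hs
    have := ih ρ g hs
    simp only [Holds] at this ⊢
    rwa [(ihH ρ g hs).obj_eq]
  | klam _ ih =>
    intro ρ g hs
    refine ⟨_, rfl, ?_⟩
    simp only [sem]
    congr 1
    funext x
    rw [(ih _ _ (hs.el x .idA)).el_eq]
  | kapp _ _ ih ih' =>
    intro ρ g hs
    refine ⟨_, rfl, ?_⟩
    simp only [sem, (ih ρ g hs).el_eq, (ih' ρ g hs).el_eq]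
  | kbeta _ _ ih ih' =>
    intro ρ g hs
    obtain ⟨x, hx, -⟩ := ih' ρ g hs
    obtain ⟨y, hy, -⟩ := ih _ _ (hs.el x .idA)
    refine ⟨y, ?_, ?_⟩
    · simp only [sem, hx, Val.toEl_el]
      exact congrArg (Val.el _) ((congrFun (Val.toEl_klam _ _ _) x).trans (by
        rw [hy, Val.toEl_el]))
    · rw [sem_inst, hx, hy]
  | keta _ ih =>
    intro ρ g hs
    obtain ⟨x, hx, -⟩ := ih ρ g hs
    refine ⟨x, ?_, hx⟩
    simp only [sem, sem_wk_one, hx, Val.toEl_el, Env.cons_zero]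
  | unit => intro ρ g hs; exact ⟨_, rfl, rfl⟩
  | bool => intro ρ g hs; exact ⟨_, rfl, rfl⟩
  | fn _ _ ih ih' =>
    intro ρ g hs
    refine ⟨_, rfl, ?_⟩
    simp only [sem, (ih ρ g hs).el_eq, (ih' ρ g hs).el_eq]
    rfl
  | all _ ih =>
    intro ρ g hs
    refine ⟨_, rfl, ?_⟩
    simp only [sem_all, fun x => (ih _ _ (hs.el x .idA)).el_eq]
    rfl
  | th _ _ ih ih' =>
    intro ρ g hs
    refine ⟨_, rfl, ?_⟩
    simp only [sem, (ih ρ g hs).obj_eq, (ih' ρ g hs).el_eq]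
    rfl
  | hfun _ _ _ iho _ ihm => intro ρ g hs; exact hfun_holds hs (iho ρ g hs) ihm
  | hdlr _ _ _ _ _ _ ihM ihr ihb ihm =>
    intro ρ g hs
    exact hdlr_holds (ihM ρ g hs) (ihr ρ g hs) (ihb ρ g hs) (ihm ρ g hs)
  | star =>
    intro ρ g hs
    simp only [Holds, sem, toTy_ofTy]
    exact ⟨_, rfl, rfl, PER.one_real _, PER.one_real _⟩
  | unitEta _ ih =>
    intro ρ g hs
    have := ih ρ g hs
    simp only [Holds, sem, toTy_ofTy] at this ⊢
    rw [this.eq_cl]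
    -- The only element of the unit type is the full set, which every element of the algebra
    -- realizes.
    exact .mk_right this.real ((PER.one_real _).unique this.real ▸ PER.one_real _) (PER.one_real _)
  | tt =>
    intro ρ g hs
    simp only [Holds, sem, toTy_ofTy]
    have : rz .tt g = Alg.church true := Alg.eval_church true g
    rw [this]
    exact ⟨_, rfl, rfl, PER.two_real _, PER.two_real _⟩
  | ff =>
    intro ρ g hs
    simp only [Holds, sem, toTy_ofTy]
    have : rz .ff g = Alg.church false := Alg.eval_church false g
    rw [this]
    exact ⟨_, rfl, rfl, PER.two_real _, PER.two_real _⟩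
  | lam _ _ _ ihA ihB ih =>
    intro ρ g hs
    have hk := hs.tm_binder ih
    simp only [Holds, sem_lam]
    rw [toTy_fn, (ihA ρ g hs).el_eq]
    -- The pattern of most congruence rules: the left erasure realizes both denotations, which makes
    -- them equal, and the right erasure realizes the right one.
    refine .mk_left (lamA_real fun n N hn => ?_) (lamA_real fun n N hn => ?_)
      (lamA_real fun n N hn => ?_) <;> rw [rz_lam_app]
    · exact (hk n N hn).real
    · exact (hk n N hn).real_right
    · exact (hk n N hn).real'
  | app _ _ _ _ ihA ihB iht ihu =>
    intro ρ g hs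
    have ht := iht ρ g hs
    have hu := ihu ρ g hs
    simp only [Holds] at ht hu ⊢
    rw [toTy_fn] at ht
    rw [sem_app, sem_app, (ihB ρ g hs).el_eq]
    exact .mk_left (PER.arr_app ht.real hu.real) (PER.arr_app ht.real_right hu.real_right)
      (PER.arr_app ht.real' hu.real')
  | @beta Γ A B t u _ _ _ _ _ _ iht ihu =>
    intro ρ g hs
    have ht := hs.tm_binder iht
    have hu := ihu ρ g hs
    simp only [Holds] at hu ⊢
    have hr := ht _ _ hu.real
    rw [sem_app, sem_lam, sem_inst, rz_inst, rz_app, rz_lam_app, hu.eq_cl, hr.eq_cl]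
    have h := PER.arr_app (lamA_real (f := rz (.lam A B t) g) fun n N hn => by
      rw [rz_lam_app]; exact (ht n N hn).real) hu.real
    rw [rz_lam_app] at h
    exact .mk_left h hr.real hr.real
  | eta _ _ _ ihA ihB iht =>
    intro ρ g hs
    have ht := iht ρ g hs
    simp only [Holds] at ht ⊢
    rw [toTy_fn] at ht ⊢
    rw [ht.eq_cl, sem_lam]
    simp only [sem_app, sem_wk_one]
    refine .mk_right (lamA_real fun n N hn => ?_) ?_ ht.real
    · rw [rz_lam_app, rz_app, rz_wk_one, rz_var]
      exact PER.arr_app ht.real hn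
    · have := PER.arr_eta ht.real
      change PER.Real _ _ (lamC _ _)
      simp only [sem, Env.cons_zero, Val.toCl_cl]
      rw [this]
      exact ht.real
  | tlam _ _ ihA ih =>
    intro ρ g hs
    simp only [Holds, sem_tlam, toTy_all]
    have hk := fun x n => ih _ _ (hs.el x n)
    simp only [Holds] at hk
    refine .mk_left (allK_lam fun x n => ?_) (allK_lam fun x n => ?_)
      (allK_lam fun x n => ?_) <;> rw [rz_tlam_app]
    · exact (hk x n).real
    · exact (hk x n).real_right
    · exact (hk x n).real'
  | tapp _ _ _ ihA iht ihF =>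
    intro ρ g hs
    have ht := iht ρ g hs
    simp only [Holds] at ht ⊢
    rw [toTy_all] at ht
    obtain ⟨x, hx, hx'⟩ := ihF ρ g hs
    simp only [sem_tapp, sem_inst, hx, hx', Val.toEl_el, (ihA _ _ (hs.el x .idA)).el_eq]
    exact .mk_left (allK_app ht.real x .idA) (allK_app ht.real_right x .idA)
      (allK_app ht.real' x .idA)
  | @tbeta Γ k A t F _ _ _ _ iht ihF =>
    intro ρ g hs
    have ht := fun x n => iht _ _ (hs.el x n)
    simp only [Holds] at ht ⊢
    obtain ⟨x, hx, -⟩ := ihF ρ g hs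
    have h := allK_app (allK_lam (f := rz (.tlam k A t) g) fun x n => by
      rw [rz_tlam_app]; exact (ht x n).real) x .idA
    rw [rz_tlam_app] at h
    rw [sem_tapp, sem_tlam, sem_inst, sem_inst, rz_inst, rz_tapp, rz_tlam_app, hx, Val.toEl_el,
      (ht x .idA).eq_cl]
    exact .mk_left h (ht x .idA).real (ht x _).real
  | teta _ _ ihA iht =>
    intro ρ g hs
    have ht := iht ρ g hs
    simp only [Holds] at ht ⊢
    rw [toTy_all] at ht ⊢
    rw [ht.eq_cl]
    simp only [sem_tlam, sem_tapp, sem_var, sem_wk_one, Env.cons_zero, Val.toEl_el, Val.toCl_cl,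
      sem_rename_liftR]
    refine .mk_right (allK_lam fun x n => ?_) ?_ ht.real
    · rw [rz_tlam_app, rz_tapp, rz_wk_one]
      exact allK_app ht.real x .idA
    · rw [allK_eta ht.real]
      exact ht.real
  | val _ _ _ ihH ihA iha =>
    intro ρ g hs
    have ha := iha ρ g hs
    simp only [Holds, sem] at ha ⊢
    rw [(ihH ρ g hs).obj_eq, (ihA ρ g hs).el_eq]
    exact .mk_left (val_real ha.real fun n d m => rz_val_app _ _ _ _ _ _ _)
      (val_real ha.real_right fun n d m => rz_val_app _ _ _ _ _ _ _)
      (val_real ha.real' fun n d m => rz_val_app _ _ _ _ _ _ _)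
  | letin _ _ _ _ _ ihH ihA ihB ihc ihk =>
    intro ρ g hs
    have hc := ihc ρ g hs
    have hk := hs.co_binder ihk
    simp only [Holds, sem] at hc ⊢
    rw [(ihH ρ g hs).obj_eq, (ihA ρ g hs).el_eq, (ihB ρ g hs).el_eq]
    exact .mk_left (rz_letin_real hc.real fun n N hn => (hk n N hn).real)
      (rz_letin_real hc.real_right fun n N hn => (hk n N hn).real_right)
      (rz_letin_real hc.real' fun n N hn => (hk n N hn).real')
  | valLet _ _ _ _ _ _ _ _ iha ihk =>
    intro ρ g hs
    have ha := iha ρ g hs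
    have hk := hs.co_binder ihk
    simp only [Holds] at ha ⊢
    rw [sem_inst, ha.eq_cl, (hk _ _ ha.real).eq_cl]
    exact val_let_elem (K := fun a => (sem _ (ρ.cons (.cl a))).toCl) ha.real
      fun n N hn => (hk n N hn).real
  | letVal _ _ _ _ _ ihc =>
    intro ρ g hs
    have hc := ihc ρ g hs
    simp only [Holds] at hc ⊢
    rw [hc.eq_cl]
    simp only [sem, sem_wk_one, Env.cons_zero, Val.toCl_cl]
    exact let_val_elem hc.real
  | letAssoc _ _ _ _ _ _ _ _ _ _ _ ihc ihk ihk' =>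
    intro ρ g hs
    have hc := ihc ρ g hs
    have hk := hs.co_binder ihk
    have hk' := hs.co_binder ihk'
    simp only [Holds] at hc ⊢
    simp only [sem, sem_wk_one, sem_rename_liftR, Val.toCl_cl]
    exact let_assoc_elem hc.real (fun n N hn => (hk n N hn).real) fun n N hn => (hk' n N hn).real
  | down _ _ _ ihH ihA ih =>
    intro ρ g hs
    have := ih ρ g hs
    simp only [Holds, toTy_th] at this ⊢
    obtain ⟨C, h, h', h1, h2⟩ := this
    exact ⟨C, by simp only [sem, h]; rfl, by simp only [sem, h']; rfl, h1, h2⟩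
  | up _ _ _ ihH ihA ih =>
    intro ρ g hs
    have := ih ρ g hs
    simp only [Holds, toTy_th] at this ⊢
    obtain ⟨C, h, h', h1, h2⟩ := this
    exact ⟨C, by simp only [sem, h]; rfl, by simp only [sem, h']; rfl, h1, h2⟩
  | downUp _ _ _ _ _ ih =>
    intro ρ g hs
    have := ih ρ g hs
    simp only [Holds, toTy_th] at this ⊢
    obtain ⟨C, h, h', h1, h2⟩ := this
    exact ⟨C, by simp only [sem, h]; rfl, h', h1, h2⟩
  | upDown _ _ _ _ _ ih =>
    intro ρ g hs
    have := ih ρ g hs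
    simp only [Holds] at this ⊢
    obtain ⟨C, h, h', h1, h2⟩ := this
    exact ⟨C, by simp only [sem, h]; rfl, h', h1, h2⟩
  | op _ _ _ _ _ ihH ihA ihB ihp ihk =>
    intro ρ g hs
    obtain ⟨h1, h2, h3⟩ := (ihH ρ g hs).hf_real
    have hp := ihp ρ g hs
    have hk := hs.co_binder ihk
    simp only [Holds] at hp ⊢
    rw [toTy_tyapp (sem_happ (sem_thObj _ _) _)] at hp
    -- Only the outermost clause is unfolded; the denotation of the functor must stay folded to
    -- match the hypotheses about it.
    have e : ∀ H A B p k, sem (.op H A B p k) ρ = .cl (opC (sem H ρ).obj (sem H ρ).hmap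
      (sem A ρ).toTy (sem B ρ).toTy (sem p ρ).toCl fun a => (sem k (ρ.cons (.cl a))).toCl) :=
      fun _ _ _ _ _ => rfl
    rw [e, e, (ihH ρ g hs).obj_eq, (ihA ρ g hs).el_eq, (ihB ρ g hs).el_eq]
    exact .mk_left (rz_op_real h1 hp.real fun n N hn => (hk n N hn).real)
      (rz_op_real h2 hp.real_right fun n N hn => (hk n N hn).real_right)
      (rz_op_real h3 hp.real' fun n N hn => (hk n N hn).real')
  | letOp _ _ _ _ _ _ _ ihH _ _ _ ihp ihk ihk' =>
    intro ρ g hs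
    obtain ⟨h1, -, -⟩ := (ihH ρ g hs).hf_real
    have hp := ihp ρ g hs
    have hk := hs.co_binder ihk
    have hk' := hs.co_binder ihk'
    simp only [Holds] at hp ⊢
    rw [toTy_tyapp (sem_happ (sem_thObj _ _) _)] at hp
    have e : ∀ H A B p k, sem (.op H A B p k) ρ = .cl (opC (sem H ρ).obj (sem H ρ).hmap
      (sem A ρ).toTy (sem B ρ).toTy (sem p ρ).toCl fun a => (sem k (ρ.cons (.cl a))).toCl) :=
      fun _ _ _ _ _ => rfl
    have e' : ∀ H A B c k ρ, sem (.letin H A B c k) ρ = .cl (letC (sem H ρ).obj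
      (sem A ρ).toTy (sem B ρ).toTy (sem c ρ).toCl fun a => (sem k (ρ.cons (.cl a))).toCl) :=
      fun _ _ _ _ _ _ => rfl
    simp only [e, e', sem_wk_one, sem_rename_liftR, Val.toCl_cl]
    exact let_op_elem h1 hp.real (fun n N hn => (hk n N hn).real) fun n N hn => (hk' n N hn).real
  | hdl _ _ _ _ ihH ihA ihh ihc =>
    intro ρ g hs
    have hc := ihc ρ g hs
    obtain ⟨eh, h1, h2⟩ := (ihh ρ g hs).hd_real
    simp only [Holds] at hc ⊢
    rw [toTy_tyapp_toEl, sem_hdl, sem_hdl, (ihA ρ g hs).el_eq, eh]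
    exact .mk_left (hdl_real hc.real h1 .idA .idA) (hdl_real hc.real_right h1 .idA .idA)
      (hdl_real hc.real' h2 .idA .idA)
  | hdlVal _ _ hh _ ihH ihA ihh iha =>
    intro ρ g hs
    have ha := iha ρ g hs
    obtain ⟨-, h1, -⟩ := (ihh ρ g hs).hd_real
    -- The expression `M` itself denotes some `F`; the type of the result and the unit on the right
    -- are computed from it.
    obtain ⟨F, hF⟩ := (shape_of_eqv hh ρ g hs).1 _ _ _ _ rfl
    simp only [Holds] at ha ⊢
    rw [toTy_tyapp hF, sem_hdl, sem_retApp hF]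
    exact hdl_val_elem ha.real h1 (by simp only [sem, hF]; rfl)
  | hdlOp _ _ _ hh _ _ ihH _ _ ihh ihp ihk =>
    intro ρ g hs
    obtain ⟨hH, -, -⟩ := (ihH ρ g hs).hf_real
    obtain ⟨-, h1, -⟩ := (ihh ρ g hs).hd_real
    obtain ⟨F, hF⟩ := (shape_of_eqv hh ρ g hs).1 _ _ _ _ rfl
    have hp := ihp ρ g hs
    have hk := hs.co_binder ihk
    simp only [Holds] at hp ⊢
    rw [toTy_tyapp (sem_happ (sem_thObj _ _) _)] at hp
    rw [toTy_tyapp hF]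
    exact hdl_op_elem hF hH h1 hp.real fun n N hn => (hk n N hn).real

end Rz

namespace Rz

open LC FHa

/-! ### Closedness of erasures -/

section

variable {e a M r b H h : Ex} {n : ℕ}

theorem closedAt_wk (he : (erase e).ClosedAt n) (k : ℕ) : (erase (e.wk k)).ClosedAt (n + k) := by
  rw [Ex.wk, erase_rename]
  exact he.rename fun i hi => by omega

theorem closedAt_rename_liftR (he : (erase e).ClosedAt (n + 1)) :
    (erase (e.rename (FHa.liftR (· + 1)))).ClosedAt (n + 1 + 1) := by
  rw [erase_rename]
  refine he.rename fun i hi => ?_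
  cases i with
  | zero => exact Nat.succ_pos _
  | succ i => simpa [FHa.liftR] using hi

theorem closedAt_scons {σ : ℕ → Ex} (ha : (erase a).ClosedAt n) {k : ℕ}
    (hσ : ∀ i < k, (erase (σ i)).ClosedAt n) : ∀ i < k + 1, (erase (Ex.scons a σ i)).ClosedAt n
  | 0, _ => ha
  | i + 1, hi => hσ i (Nat.lt_of_succ_lt_succ hi)

theorem closedAt_inst (he : (erase e).ClosedAt (n + 1)) (ha : (erase a).ClosedAt n) :
    (erase (e.inst a)).ClosedAt n := by
  rw [Ex.inst, erase_subst]
  exact he.subst (closedAt_scons ha fun i hi => hi)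

@[simp] theorem closedAt_idT : Tm.idT.ClosedAt n := by simp [Tm.idT, Tm.ClosedAt]

@[simp] theorem closedAt_pairT : Tm.pairT.ClosedAt n := by simp [Tm.pairT, Tm.ClosedAt]

@[simp] theorem closedAt_church (c : Bool) : (Tm.church c).ClosedAt n :=
  (Tm.church_closed c).mono (Nat.zero_le n)

@[simp] theorem closedAt_valT : Tm.valT.ClosedAt n := by simp [Tm.valT, Tm.ClosedAt]

@[simp] theorem closedAt_letT : Tm.letT.ClosedAt n := by
  simp only [Tm.letT, Tm.ClosedAt]; omega

@[simp] theorem closedAt_fctT : Tm.fctT.ClosedAt n := by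
  simp [Tm.fctT, Tm.ClosedAt]

@[simp] theorem closedAt_opT : Tm.opT.ClosedAt n := by
  simp [Tm.opT, Tm.ClosedAt, Tm.hdlTransT, Tm.rename, Tm.fstT, Tm.sndT]

theorem closedAt_fctOfMnd (hr : (erase r).ClosedAt n) (hb : (erase b).ClosedAt n) :
    (erase (.fctOfMnd M r b)).ClosedAt n := by
  have h4 := closedAt_wk hb 4
  have h5 := closedAt_wk hr 5
  simp [Ex.fctOfMnd, Ex.bindApp, Ex.retApp, erase, Tm.ClosedAt, h4, h5]

theorem closedAt_thRet : (erase (.thRet H)).ClosedAt n := by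
  simp [Ex.thRet, erase, Tm.ClosedAt]

theorem closedAt_thBind : (erase (.thBind H)).ClosedAt n := by
  simp [Ex.thBind, erase, Tm.ClosedAt]

theorem closedAt_hdlTrans (hh : (erase h).ClosedAt n) :
    (erase (.hdlTrans H M h)).ClosedAt n := by
  have := closedAt_wk hh 2
  simp [Ex.hdlTrans, erase, Tm.ClosedAt, Tm.fstT, this]

end

theorem lookup_lt {Γ : Ctx} {i : ℕ} {J : Judg} (h : Lookup Γ i J) : i < Γ.length := by
  induction h with
  | zero => simp
  | succ _ _ ih => simpa using ih

/-- Closedness of the erasures of elements of kinds and of monads of handlers. -/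
def KindClosed (J : Judg) (e : Ex) (n : ℕ) : Prop :=
  match J with
  | .el _ => (erase e).ClosedAt n
  | .hdlr _ => ∀ M r b m, e = .hdlr M r b m → (erase M).ClosedAt n
  | _ => True

/-- Erasing a handler drops its monad `M`, so closedness of the erased handler says nothing about
`M`. The right side of the law for handled operations substitutes `M` into `hmap`, which is where
this is needed. -/
theorem kindClosed_of_eqv {Γ : Ctx} {e e' : Ex} {J : Judg} (h : Eqv Γ e e' J) :
    KindClosed J e Γ.length ∧ KindClosed J e' Γ.length := by
  induction h with
  | @var Γ i J h =>
    cases J with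
    | el k => exact ⟨lookup_lt h, lookup_lt h⟩
    | hdlr H => exact ⟨fun _ _ _ _ h => (nomatch h), fun _ _ _ _ h => (nomatch h)⟩
    | _ => exact ⟨trivial, trivial⟩
  | symm _ ih => exact ih.symm
  | trans _ _ ih ih' => exact ⟨ih.1, ih'.2⟩
  | convHdlr _ _ _ ih => exact ih
  | kbeta _ _ ih ih' => exact ⟨closedAt_idT, closedAt_inst ih.1 ih'.1⟩
  | keta _ ih => exact ⟨closedAt_idT, ih.1⟩
  | hdlr _ _ _ _ _ _ ih =>
    constructor
    · rintro _ _ _ _ ⟨⟩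
      exact ih.1
    · rintro _ _ _ _ ⟨⟩
      exact ih.2
  | klam | kapp | unit | bool | fn | all | th => exact ⟨closedAt_idT, closedAt_idT⟩
  | _ => exact ⟨trivial, trivial⟩

/-- Closedness is invisible to realizability, as environments assign values to all variables. It is
proved by its own induction, in which the laws involving substitution or weakening need attention.
-/
theorem closedAt_of_eqv {Γ : Ctx} {e e' : Ex} {J : Judg} (h : Eqv Γ e e' J) :
    (erase e).ClosedAt Γ.length ∧ (erase e').ClosedAt Γ.length := by
  induction h with
  | var h => exact ⟨lookup_lt h, lookup_lt h⟩
  | kbeta _ _ ih ih' => exact ⟨closedAt_idT, closedAt_inst ih.1 ih'.1⟩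
  | keta _ ih => exact ⟨closedAt_idT, ih.1⟩
  | beta _ _ _ _ _ _ ih ih' => exact ⟨⟨ih.1, ih'.1⟩, closedAt_inst ih.1 ih'.1⟩
  | eta _ _ _ _ _ ih => exact ⟨⟨closedAt_wk ih.1 1, Nat.succ_pos _⟩, ih.1⟩
  | tbeta _ _ _ _ ih ih' => exact ⟨⟨ih.1, closedAt_idT⟩, closedAt_inst ih.1 ih'.1⟩
  | teta _ _ _ ih => exact ⟨⟨closedAt_wk ih.1 1, closedAt_idT⟩, ih.1⟩
  | valLet _ _ _ _ _ _ _ _ iha ihk =>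
    exact ⟨⟨⟨closedAt_letT, closedAt_valT, iha.1⟩, ihk.1⟩, closedAt_inst ihk.1 iha.1⟩
  | letAssoc _ _ _ _ _ _ _ _ _ _ _ ihc ihk ihk' =>
    have := closedAt_rename_liftR ihk'.1
    simp_all [erase, Tm.ClosedAt]
  | letOp _ _ _ _ _ _ _ _ _ _ _ ihp ihk ihk' =>
    have := closedAt_rename_liftR ihk'.1
    simp_all [erase, Tm.ClosedAt]
  | @hdlOp Γ o f q A B M r b m p k _ _ _ hh _ _ ihH _ _ ihh ihp ihk =>
    have hM := (kindClosed_of_eqv hh).1 M r b m rfl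
    have hk := ihk.1
    have hwk := closedAt_wk ihh.1 1
    have hτ := closedAt_hdlTrans (H := .hfun o f q) (M := M) ihh.1
    obtain ⟨⟨-, hr⟩, ⟨-, hb⟩, hm⟩ := ihh.1
    -- The erased `hmap` lives under five more binders than the context; closed erasures are
    -- supplied for all five, that of the thunk object being the identity.
    have hq : (erase (.hmapAt q (.thObj (.hfun o f q))
        (.fctOfMnd (.thObj (.hfun o f q)) (.thRet (.hfun o f q)) (.thBind (.hfun o f q))) M
        (.fctOfMnd M r b) (.hdlTrans (.hfun o f q) M (.hdlr M r b m)))).ClosedAt Γ.length := by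
      rw [Ex.hmapAt, erase_subst]
      exact Tm.ClosedAt.subst (n := Γ.length + 1 + 1 + 1 + 1 + 1) ihH.1
        (closedAt_scons hτ (closedAt_scons (closedAt_fctOfMnd hr hb) (closedAt_scons hM
          (closedAt_scons (closedAt_fctOfMnd closedAt_thRet closedAt_thBind)
            (closedAt_scons closedAt_idT fun i hi => hi)))))
    refine ⟨⟨⟨⟨⟨⟨⟨closedAt_opT, ihH.1⟩, ihp.1⟩, hk⟩, ihh.1⟩, closedAt_idT⟩,
      ⟨ihh.1, closedAt_church _⟩, closedAt_idT⟩, ?_⟩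
    exact ⟨⟨⟨⟨hb, closedAt_idT⟩, closedAt_idT⟩, ⟨hm, closedAt_idT⟩, ⟨hq, closedAt_idT⟩, ihp.1⟩,
      ⟨⟨hk, hwk⟩, closedAt_idT⟩, ⟨hwk, closedAt_church _⟩, closedAt_idT⟩
  | _ => simp_all [erase, Ex.retApp, Tm.ClosedAt, Tm.fstT]

/-- The closed lambda-term extracted from a closed term of type `bool`: its erasure. -/
def extract (t : ClosedBool) : CTm := ⟨erase t.1, (closedAt_of_eqv t.2).1⟩

/-! ### Extraction and normalisation -/

theorem rz_closed {e : Ex} (he : (erase e).Closed) (g : ℕ → Alg) :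
    rz e g = Alg.mk ⟨erase e, he⟩ := by
  simp only [rz, Alg.eval, he.subst_eq (σ := fun i => (Quotient.out (g i)).1) (by simp)]

theorem extract_elem {t t' : ClosedBool} (h : t.JEq t') :
    Elem .two (sem t.1 fun _ => .cl ∅) (sem t'.1 fun _ => .cl ∅)
      (Alg.mk (extract t)) (Alg.mk (extract t')) := by
  have := soundness h _ (fun _ => .idA) (Sat.nil (fun _ => .cl ∅) _)
  simp only [Holds, sem, toTy_ofTy] at this
  rwa [rz_closed (extract t).2, rz_closed (extract t').2] at this

theorem exists_normalisesTo {t t' : ClosedBool} (h : t.JEq t') :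
    ∃ b : Bool, (extract t).1.NormalisesTo (Tm.church b) ∧
      (extract t').1.NormalisesTo (Tm.church b) := by
  obtain ⟨C, -, -, h, h'⟩ := extract_elem h
  -- Relatedness in `two` means that both classes equal the class of one and the same Church
  -- Boolean.
  obtain ⟨b, hb, hb'⟩ := h.rel h'
  exact ⟨b, (Tm.BetaEq.normalisesTo (Quotient.exact hb) (Tm.church_normal b)),
    (Tm.BetaEq.normalisesTo (Quotient.exact hb') (Tm.church_normal b))⟩

end Rz

/-- Program extraction.  Every closed term `t : tm bool` denotes an element of the two-element type
of the realizability model over the lambda-terms, this element is realized by a closed lambda-term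
`|t|`, and `|t|` normalises to a Church Boolean; judgementally equal terms give lambda-terms
normalising to the same Church Boolean. -/
theorem mainTheorem4 :
    ∃ extract : FHa.ClosedBool → LC.CTm,
      (∀ t : FHa.ClosedBool,
        (∃ x : Rz.PER.two.asm.Carrier,
          x.1 = Rz.semBool t ∧ Rz.PER.two.asm.real (LC.Alg.mk (extract t)) x) ∧
        ∃ b : Bool, (extract t).1.NormalisesTo (LC.Tm.church b)) ∧
      ∀ t t' : FHa.ClosedBool, t.JEq t' →
        ∃ b : Bool, (extract t).1.NormalisesTo (LC.Tm.church b) ∧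
          (extract t').1.NormalisesTo (LC.Tm.church b) := by
  refine ⟨Rz.extract, fun t => ⟨?_, ?_⟩, fun t t' h => Rz.exists_normalisesTo h⟩
  · have h := (Rz.extract_elem (t := t) (t' := t) t.2).real
    exact ⟨⟨Rz.semBool t, h.isClass⟩, rfl, h.mem⟩
  · obtain ⟨b, hb, -⟩ := Rz.exists_normalisesTo (t := t) (t' := t) t.2
    exact ⟨b, hb⟩
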